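/- **Setting.** Let $V:\mathbb R^n\to\mathbb R^m$ be linear, $V^T$ its transpose, $u_b\in\mathbb R^m$, $\alpha_0,\alpha>0$; all norms $\|\cdot\|$ are Euclidean (also on products). Put $h(y)=\frac12\|y-u_b\|^2$, $p(\mu)=\frac{\alpha_0}2\|\mu\|^2+\alpha\|\mu\|_1$, $\mathcal P(\mu)=h(V\mu)+p(\mu)$, and let $\mathcal X^P$ be the set of minimizers of $\mathcal P$. With the Fenchel conjugates $h^*,p^*$ let $$l(y,z,\lambda)=p^*(z)+h^*(y)+\langle\lambda,V^Ty+z\rangle,\qquad L_\sigma(y,z;\lambda)=l(y,z,\lambda)+\tfrac\sigma2\|V^Ty+z\|^2$$ be the Lagrangian and the augmented Lagrangian of the dual problem $\min_{y,z}p^*(z)+h^*(y)$ subject to $V^Ty+z=0$. A KKT point is a triple with $0=\nabla h^*(y)+V\lambda$, $0\in\partial p^*(z)+\lambda$, $V^Ty+z=0$. Let $T_l(y,z,\lambda)=\{(y',z',\lambda'):(y',z',-\lambda')\in\partial l(y,z,\lambda)\}$ (subgradient in $(y,z)$, supergradient in $\lambda$). A multivalued map $F$ is metrically subregular at $\bar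 x$ for $\bar y\in F(\bar x)$ with modulus $\kappa\ge0$ if, for some neighbourhoods $U$ of $\bar x$ and $W$ of $\bar y$, $\mathrm{dist}(x,F^{-1}(\bar y))\le\kappa\,\mathrm{dist}(\bar y,F(x)\cap W)$ for all $x\in U$, where the distance to $\emptyset$ is $+\infty$. **Algorithm (ALM-bd-SSN).** Let $0<\sigma_0\le\sigma_1\le\cdots$ with $\sigma_k\to\sigma_\infty\in(0,\infty]$, $\beta\in(0,1)$, $c>0$, and let $(y^0,z^0,\lambda^0)$ be arbitrary. Put $$F_k(y)=y+u_b-V(I+\sigma_k\partial p)^{-1}(-\lambda^k-\sigma_kV^Ty),$$ $$\mathcal M^k(y)=\tfrac1{\sigma_k}\big[-\sigma_kV^Ty-\lambda^k-(I+\sigma_k\partial p)^{-1}(-\sigma_kV^Ty-\lambda^k)\big].$$ Given $(y^k,z^k,\lambda^k)$, $y^{k+1}$ is obtained from $y^k$ by finitely many inner steps $w\mapsto w+\beta^td$. Here $d$ solves $\big(I+\frac{\sigma_k}{1+\sigma_k\alpha_0}V\,\mathrm{diag}(\chi)V^T\big)d=-F_k(w)$, where $\chi_i=1$, $\chi_i=0$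 or $\chi_i\in[0,1]$ according as $|(\lambda^k+\sigma_kV^Tw)_i|$ is $>$, $<$ or $=\sigma_k\alpha$, and $t\in\{0,1,2,\dots\}$ is the smallest integer with $$L_{\sigma_k}(w+\beta^td,\mathcal M^k(w+\beta^td);\lambda^k)\le L_{\sigma_k}(w,\mathcal M^k(w);\lambda^k)-c\beta^t\|d\|^2.$$ Then $z^{k+1}=\mathcal M^k(y^{k+1})$ and $\lambda^{k+1}=\lambda^k+\sigma_k(V^Ty^{k+1}+z^{k+1})$. **Stopping criteria** (for all $k\geq 0$): (A) $L_{\sigma_k}(y^{k+1},z^{k+1};\lambda^k)-\inf_{y,z}L_{\sigma_k}(y,z;\lambda^k)\le\epsilon_k^2/(2\sigma_k)$, $\epsilon_k\ge0$, $\sum_k\epsilon_k<\infty$; (B1) $L_{\sigma_k}(y^{k+1},z^{k+1};\lambda^k)-\inf_{y,z}L_{\sigma_k}(y,z;\lambda^k)\le\frac{\delta_k^2}{2\sigma_k}\|\lambda^{k+1}-\lambda^k\|^2$, $\delta_k\ge0$, $\sum_k\delta_k<\infty$; (B2) $\mathrm{dist}\big(0,\partial_{(y,z)}L_{\sigma_k}(y^{k+1},z^{k+1};\lambda^k)\big)\le\frac{\delta_k'}{\sigma_k}\|\lambda^{k+1}-\lambda^k\|$,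 $0\le\delta_k'\to0$. **Theorem.** Let $(y^k,z^k,\lambda^k)$ be generated by ALM-bd-SSN and satisfy (A). 1. The sequence is bounded and converges, for every initial point, to a KKT point $(y^*,z^*,\lambda^*)$, and $-\lambda^*\in\mathcal X^P$. 2. $\partial\mathcal P$ is metrically subregular at $-\lambda^*$ for the origin. If $\kappa_d$ is any modulus of this subregularity and (B1) also holds, then for all sufficiently large $k$ $$\mathrm{dist}(-\lambda^{k+1},\mathcal X^P)\le\theta_k\,\mathrm{dist}(-\lambda^k,\mathcal X^P),\qquad \theta_k=\frac{\kappa_d(\kappa_d^2+\sigma_k^2)^{-1/2}+\delta_k}{1-\delta_k},$$ and $\theta_k\to\theta_\infty=\kappa_d(\kappa_d^2+\sigma_\infty^2)^{-1/2}<1$ (with $\theta_\infty=0$ if $\sigma_\infty=\infty$). 3. $T_l$ is metrically subregular at $(y^*,z^*,\lambda^*)$ for the origin. If $\kappa_l$ is any modulus of this subregularity and (B2) holds in addition to (A), then for all sufficiently large $k$ $$\|(y^{k+1},z^{k+1})-(y^*,z^*)\|\le\theta_k'\|\lambda^{k+1}-\lambda^k\|,\qquad\theta_k'=\kappa_l(1+\delta_k')/\sigma_k,$$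 and $\theta'_k\to\kappa_l/\sigma_\infty$ (which is $0$ if $\sigma_\infty=\infty$). -/

import Mathlib

open Filter Topology

noncomputable section

/-! ### Notions from convex and variational analysis -/

/-- The Fenchel conjugate `f*(v) = sup_x (⟨x, v⟩ - f x)` of a real function. It is used below only
for functions for which the supremum is finite, see `SparseSource.bddAbove_h` and
`SparseSource.bddAbove_p`. -/
def fenchelConj {E : Type*} [NormedAddCommGroup E] [InnerProductSpace ℝ E]
    (f : E → ℝ) (v : E) : ℝ :=
  ⨆ x : E, (inner ℝ x v - f x)

/-- The convex subdifferential of a finite real function. -/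
def subdiff {E : Type*} [NormedAddCommGroup E] [InnerProductSpace ℝ E]
    (f : E → ℝ) (x : E) : Set E :=
  {v | ∀ x' : E, f x + inner ℝ v (x' - x) ≤ f x'}

/-- The multivalued mapping `F` is metrically subregular at `xbar` for `ybar` with modulus `κ`:
`ybar ∈ F xbar` and `dist (x, F⁻¹ ybar) ≤ κ dist (ybar, F x ∩ V)` for all `x ∈ U`, for some
neighbourhoods `U` of `xbar` and `V` of `ybar`. The distance to the empty set is `+∞`, so the
inequality only has content when `F x ∩ V` is nonempty. -/
def MetricallySubregular {E G : Type*} [PseudoMetricSpace E] [PseudoMetricSpace G]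
    (F : E → Set G) (xbar : E) (ybar : G) (κ : ℝ) : Prop :=
  ybar ∈ F xbar ∧ 0 ≤ κ ∧ ∃ U ∈ 𝓝 xbar, ∃ V ∈ 𝓝 ybar, ∀ x ∈ U, (F x ∩ V).Nonempty →
    Metric.infDist x {x' | ybar ∈ F x'} ≤ κ * Metric.infDist ybar (F x ∩ V)

/-- Scalar soft thresholding. -/
def softThreshold (τ t : ℝ) : ℝ :=
  if |t| ≤ τ then 0 else t - τ * SignType.sign t

/-! ### The discrete sparse source problem -/

/-- The data of the discrete problem, after realification of all complex quantities: the boundary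
operator, the measured data and the two regularization parameters. -/
structure SparseSource (m n : ℕ) where
  /-- The (discrete) boundary operator. -/
  V : EuclideanSpace ℝ (Fin n) →L[ℝ] EuclideanSpace ℝ (Fin m)
  /-- The measured boundary data. -/
  ub : EuclideanSpace ℝ (Fin m)
  /-- The weight of the squared `ℓ²` norm. -/
  α₀ : ℝ
  /-- The weight of the `ℓ¹` norm. -/
  α : ℝ
  α₀_pos : 0 < α₀
  α_pos : 0 < α

namespace SparseSource

variable {m n : ℕ} (D : SparseSource m n)

/-- The transpose of the boundary operator. -/
def VT : EuclideanSpace ℝ (Fin m) →L[ℝ] EuclideanSpace ℝ (Fin n) :=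
  ContinuousLinearMap.adjoint D.V

/-- The data term `h(y) = ½‖y - u_b‖²`. -/
def h (y : EuclideanSpace ℝ (Fin m)) : ℝ := 1 / 2 * ‖y - D.ub‖ ^ 2

/-- The regularizer `p(μ) = (α₀/2)‖μ‖² + α‖μ‖₁`. -/
def p (μ : EuclideanSpace ℝ (Fin n)) : ℝ := D.α₀ / 2 * ‖μ‖ ^ 2 + D.α * ∑ i, |μ i|

/-- The primal objective `P(μ) = h(V μ) + p(μ)`. -/
def primal (μ : EuclideanSpace ℝ (Fin n)) : ℝ := D.h (D.V μ) + D.p μ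

/-- The solution set of the primal problem. -/
def solutionSet : Set (EuclideanSpace ℝ (Fin n)) := {μ | ∀ μ', D.primal μ ≤ D.primal μ'}

/-- The conjugate of `h`. -/
def hStar : EuclideanSpace ℝ (Fin m) → ℝ := fenchelConj D.h

/-- The conjugate of `p`. -/
def pStar : EuclideanSpace ℝ (Fin n) → ℝ := fenchelConj D.p

theorem bddAbove_h (v : EuclideanSpace ℝ (Fin m)) :
    BddAbove (Set.range fun x => inner ℝ x v - D.h x) := by
  refine ⟨inner ℝ D.ub v + ‖v‖ ^ 2 / 2, ?_⟩
  rintro _ ⟨x, rfl⟩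
  have h1 : inner ℝ x v = inner ℝ (x - D.ub) v + inner ℝ D.ub v := by
    rw [inner_sub_left]; ring
  have h2 := real_inner_le_norm (x - D.ub) v
  simp only [h]
  nlinarith [sq_nonneg (‖x - D.ub‖ - ‖v‖)]

theorem bddAbove_p (v : EuclideanSpace ℝ (Fin n)) :
    BddAbove (Set.range fun x => inner ℝ x v - D.p x) := by
  refine ⟨‖v‖ ^ 2 / (2 * D.α₀), ?_⟩
  rintro _ ⟨x, rfl⟩
  have h2 := real_inner_le_norm x v
  have h3 : 0 ≤ D.α * ∑ i, |x i| :=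
    mul_nonneg D.α_pos.le (Finset.sum_nonneg fun i _ => abs_nonneg _)
  have h0 := D.α₀_pos
  simp only [p]
  have h4 : ‖x‖ * ‖v‖ ≤ D.α₀ / 2 * ‖x‖ ^ 2 + ‖v‖ ^ 2 / (2 * D.α₀) := by
    have : D.α₀ / 2 * ‖x‖ ^ 2 + ‖v‖ ^ 2 / (2 * D.α₀) - ‖x‖ * ‖v‖
        = (D.α₀ * ‖x‖ - ‖v‖) ^ 2 / (2 * D.α₀) := by field_simp; ring
    have h5 : 0 ≤ (D.α₀ * ‖x‖ - ‖v‖) ^ 2 / (2 * D.α₀) := by positivity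
    linarith
  linarith

/-- The Lagrangian `l(y, z, lam) = p*(z) + h*(y) + ⟨lam, Vᵀ y + z⟩` of the dual problem
`min p*(z) + h*(y)` subject to `Vᵀ y + z = 0`. -/
def lag (y : EuclideanSpace ℝ (Fin m)) (z lam : EuclideanSpace ℝ (Fin n)) : ℝ :=
  D.pStar z + D.hStar y + inner ℝ lam (D.VT y + z)

/-- The augmented Lagrangian. -/
def augLag (σ : ℝ) (y : EuclideanSpace ℝ (Fin m)) (z lam : EuclideanSpace ℝ (Fin n)) : ℝ :=
  D.lag y z lam + σ / 2 * ‖D.VT y + z‖ ^ 2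

/-- The KKT system of the dual problem: `0 = ∇h*(y) + V lam`, `0 ∈ ∂p*(z) + lam`,
`Vᵀ y + z = 0`. -/
def IsKKT (y : EuclideanSpace ℝ (Fin m)) (z lam : EuclideanSpace ℝ (Fin n)) : Prop :=
  -D.V lam ∈ subdiff D.hStar y ∧ -lam ∈ subdiff D.pStar z ∧ D.VT y + z = 0

/-- The space of the pairs `(y, z)`, with the Euclidean norm. -/
abbrev YZ (m n : ℕ) : Type := WithLp 2 (EuclideanSpace ℝ (Fin m) × EuclideanSpace ℝ (Fin n))

/-- The space of the triples `(y, z, lam)`, with the Euclidean norm. -/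
abbrev YZL (m n : ℕ) : Type := WithLp 2 (YZ m n × EuclideanSpace ℝ (Fin n))

/-- The pair `(y, z)` as a point of `YZ`. -/
def mkYZ (y : EuclideanSpace ℝ (Fin m)) (z : EuclideanSpace ℝ (Fin n)) : YZ m n :=
  WithLp.toLp 2 (y, z)

/-- The triple `(y, z, lam)` as a point of `YZL`. -/
def mkYZL (y : EuclideanSpace ℝ (Fin m)) (z lam : EuclideanSpace ℝ (Fin n)) : YZL m n :=
  WithLp.toLp 2 (mkYZ y z, lam)

/-- The maximal monotone operator of the convex-concave Lagrangian:
`(y', z', lam') ∈ T_l(y, z, lam)` iff `(y', z', -lam') ∈ ∂l(y, z, lam)`, that is, `(y', z')` is a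
subgradient of the convex function `l(·, ·, lam)` and `-lam'` is a supergradient of the concave
function `l(y, z, ·)`. -/
def Tl (x : YZL m n) : Set (YZL m n) :=
  {x' | x'.fst ∈ subdiff (fun w : YZ m n => D.lag w.fst w.snd x.snd) x.fst ∧
    x'.snd ∈ subdiff (fun lam => -D.lag x.fst.fst x.fst.snd lam) x.snd}

/-! ### The algorithm -/

/-- The resolvent `(I + σ ∂p)⁻¹`, computed componentwise by soft thresholding, see
`sub_resolvent_mem`. -/
def resolvent (σ : ℝ) (v : EuclideanSpace ℝ (Fin n)) : EuclideanSpace ℝ (Fin n) :=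
  WithLp.toLp 2 fun i =>
    softThreshold (σ * D.α / (1 + σ * D.α₀)) (v i / (1 + σ * D.α₀))

/-- `resolvent σ v` solves the inclusion `v ∈ w + σ ∂p(w)`. -/
theorem sub_resolvent_mem {σ : ℝ} (hσ : 0 < σ) (v : EuclideanSpace ℝ (Fin n)) :
    σ⁻¹ • (v - D.resolvent σ v) ∈ subdiff D.p (D.resolvent σ v) := by
  intro x
  have h0 := D.α₀_pos
  have h1 := D.α_pos
  have hd : 0 < 1 + σ * D.α₀ := by positivity
  simp only [p, EuclideanSpace.norm_sq_eq, Real.norm_eq_abs, sq_abs, Finset.mul_sum,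
    PiLp.inner_apply, ← Finset.sum_add_distrib]
  refine Finset.sum_le_sum fun i _ => ?_
  simp only [resolvent, PiLp.smul_apply, PiLp.sub_apply, smul_eq_mul, RCLike.inner_apply,
    conj_trivial]
  generalize x i = t
  generalize v i = s
  set w := softThreshold (σ * D.α / (1 + σ * D.α₀)) (s / (1 + σ * D.α₀)) with hw
  suffices hs : ∃ q : ℝ, σ⁻¹ * (s - w) = D.α₀ * w + D.α * q ∧ |q| ≤ 1 ∧ q * w = |w| by
    obtain ⟨q, hq, hq1, hq2⟩ := hs
    rw [hq]
    have h3 : q * t ≤ |t| := by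
      calc q * t ≤ |q * t| := le_abs_self _
        _ = |q| * |t| := abs_mul _ _
        _ ≤ 1 * |t| := by gcongr
        _ = |t| := one_mul _
    have h4 : D.α * (q * t) ≤ D.α * |t| := by gcongr
    rw [← hq2]
    nlinarith [mul_nonneg h0.le (sq_nonneg (t - w))]
  have hcase : |s / (1 + σ * D.α₀)| ≤ σ * D.α / (1 + σ * D.α₀) ↔ |s| ≤ σ * D.α := by
    rw [abs_div, abs_of_pos hd, div_le_div_iff_of_pos_right hd]
  by_cases hc : |s| ≤ σ * D.α
  · have hw0 : w = 0 := by rw [hw, softThreshold, if_pos (hcase.2 hc)]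
    refine ⟨s / (σ * D.α), ?_, ?_, ?_⟩
    · rw [hw0]; field_simp; ring
    · rw [abs_div, abs_of_pos (mul_pos hσ h1), div_le_one (mul_pos hσ h1)]; exact hc
    · simp [hw0]
  · have hw0 : w = s / (1 + σ * D.α₀)
        - σ * D.α / (1 + σ * D.α₀) * (SignType.sign (s / (1 + σ * D.α₀)) : ℝ) := by
      rw [hw, softThreshold, if_neg (fun hh => hc (hcase.1 hh))]
    rcases lt_trichotomy s 0 with hs | hs | hs
    · rw [sign_neg (div_neg_of_neg_of_pos hs hd)] at hw0
      rw [abs_of_neg hs] at hc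
      have hw1 : w = (s + σ * D.α) / (1 + σ * D.α₀) := by rw [hw0]; simp; ring
      have hneg : w < 0 := by rw [hw1]; exact div_neg_of_neg_of_pos (by linarith) hd
      refine ⟨-1, ?_, by simp, by rw [abs_of_neg hneg]; ring⟩
      rw [hw1]; field_simp; ring
    · exfalso; apply hc; rw [hs, abs_zero]; positivity
    · rw [sign_pos (div_pos hs hd)] at hw0
      rw [abs_of_pos hs] at hc
      have hw1 : w = (s - σ * D.α) / (1 + σ * D.α₀) := by rw [hw0]; simp; ring
      have hpos : 0 < w := by rw [hw1]; exact div_pos (by linarith) hd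
      refine ⟨1, ?_, by simp, by rw [abs_of_pos hpos]; ring⟩
      rw [hw1]; field_simp; ring

/-- The map `M^k` that recovers `z` from `y`. -/
def recoverZ (σ : ℝ) (lam : EuclideanSpace ℝ (Fin n)) (y : EuclideanSpace ℝ (Fin m)) :
    EuclideanSpace ℝ (Fin n) :=
  σ⁻¹ • (-σ • D.VT y - lam - D.resolvent σ (-σ • D.VT y - lam))

/-- The nonlinear function `F_k(y) = y + u_b - V (I + σ ∂p)⁻¹(-lam - σ Vᵀ y)` whose zero is the
`y`-component of the minimizer of the augmented Lagrangian. -/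
def newtonF (σ : ℝ) (lam : EuclideanSpace ℝ (Fin n)) (y : EuclideanSpace ℝ (Fin m)) :
    EuclideanSpace ℝ (Fin m) :=
  y + D.ub - D.V (D.resolvent σ (-lam - σ • D.VT y))

/-- `χ` is an admissible choice of the diagonal in the semismooth Newton derivative at `y`. -/
def IsActiveWeight (σ : ℝ) (lam : EuclideanSpace ℝ (Fin n)) (y : EuclideanSpace ℝ (Fin m))
    (χ : Fin n → ℝ) : Prop :=
  ∀ i, (σ * D.α < |(lam + σ • D.VT y) i| → χ i = 1) ∧
    (|(lam + σ • D.VT y) i| < σ * D.α → χ i = 0) ∧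
    (|(lam + σ • D.VT y) i| = σ * D.α → χ i ∈ Set.Icc (0 : ℝ) 1)

/-- The element `I + (σ / (1 + σ α₀)) V diag(χ) Vᵀ` of the semismooth Newton derivative, applied
to `d`. -/
def newtonDeriv (σ : ℝ) (χ : Fin n → ℝ) (d : EuclideanSpace ℝ (Fin m)) :
    EuclideanSpace ℝ (Fin m) :=
  d + (σ / (1 + σ * D.α₀)) • D.V (WithLp.toLp 2 fun i => χ i * (D.VT d) i)

/-- The Armijo condition of the line search for the step size `β ^ t` in the direction `d`. -/
def Armijo (σ β c : ℝ) (lam : EuclideanSpace ℝ (Fin n)) (y d : EuclideanSpace ℝ (Fin m))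
    (t : ℕ) : Prop :=
  D.augLag σ (y + β ^ t • d) (D.recoverZ σ lam (y + β ^ t • d)) lam ≤
    D.augLag σ y (D.recoverZ σ lam y) lam - c * β ^ t * ‖d‖ ^ 2

/-- One inner iteration: a semismooth Newton direction `d`, followed by the Armijo line search
with the smallest admissible exponent `t`. -/
def SSNStep (σ β c : ℝ) (lam : EuclideanSpace ℝ (Fin n)) (y y' : EuclideanSpace ℝ (Fin m)) :
    Prop :=
  ∃ (χ : Fin n → ℝ) (d : EuclideanSpace ℝ (Fin m)) (t : ℕ),
    D.IsActiveWeight σ lam y χ ∧ D.newtonDeriv σ χ d = -D.newtonF σ lam y ∧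
    D.Armijo σ β c lam y d t ∧ (∀ s < t, ¬ D.Armijo σ β c lam y d s) ∧
    y' = y + β ^ t • d

/-- `(y k, z k, lam k)` is generated by ALM-bd-SSN with the penalty parameters `σ k` and the line
search parameters `β`, `c`, from the arbitrary initial point `(y 0, z 0, lam 0)`: in every outer
step, `y (k + 1)` is the result of some finite number of inner iterations started at `y k`. -/
def IsALMbdSSN (σ : ℕ → ℝ) (β c : ℝ) (y : ℕ → EuclideanSpace ℝ (Fin m))
    (z lam : ℕ → EuclideanSpace ℝ (Fin n)) : Prop :=
  ∀ k, (∃ (L : ℕ) (w : ℕ → EuclideanSpace ℝ (Fin m)), w 0 = y k ∧ w L = y (k + 1) ∧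
      ∀ l < L, D.SSNStep (σ k) β c (lam k) (w l) (w (l + 1))) ∧
    z (k + 1) = D.recoverZ (σ k) (lam k) (y (k + 1)) ∧
    lam (k + 1) = lam k + σ k • (D.VT (y (k + 1)) + z (k + 1))

/-! ### The stopping criteria -/

/-- The optimality gap `L_σ(y, z; lam) - inf L_σ(·, ·; lam)` of the inner problem. -/
def gap (σ : ℝ) (y : EuclideanSpace ℝ (Fin m)) (z lam : EuclideanSpace ℝ (Fin n)) : ℝ :=
  D.augLag σ y z lam -
    ⨅ w : EuclideanSpace ℝ (Fin m) × EuclideanSpace ℝ (Fin n), D.augLag σ w.1 w.2 lam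

/-- Stopping criterion (A). -/
def StopA (σ ε : ℕ → ℝ) (y : ℕ → EuclideanSpace ℝ (Fin m))
    (z lam : ℕ → EuclideanSpace ℝ (Fin n)) : Prop :=
  (∀ k, 0 ≤ ε k) ∧ Summable ε ∧
    ∀ k, D.gap (σ k) (y (k + 1)) (z (k + 1)) (lam k) ≤ ε k ^ 2 / (2 * σ k)

/-- Stopping criterion (B1). -/
def StopB1 (σ δ : ℕ → ℝ) (y : ℕ → EuclideanSpace ℝ (Fin m))
    (z lam : ℕ → EuclideanSpace ℝ (Fin n)) : Prop :=
  (∀ k, 0 ≤ δ k) ∧ Summable δ ∧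
    ∀ k, D.gap (σ k) (y (k + 1)) (z (k + 1)) (lam k) ≤
      δ k ^ 2 / (2 * σ k) * ‖lam (k + 1) - lam k‖ ^ 2

/-- Stopping criterion (B2). -/
def StopB2 (σ δ' : ℕ → ℝ) (y : ℕ → EuclideanSpace ℝ (Fin m))
    (z lam : ℕ → EuclideanSpace ℝ (Fin n)) : Prop :=
  (∀ k, 0 ≤ δ' k) ∧ Tendsto δ' atTop (𝓝 0) ∧
    ∀ k, Metric.infDist 0
        (subdiff (fun w : YZ m n => D.augLag (σ k) w.fst w.snd (lam k))
          (mkYZ (y (k + 1)) (z (k + 1)))) ≤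
      δ' k / σ k * ‖lam (k + 1) - lam k‖

end SparseSource

/-- `κ (κ² + s²)^{-1/2}`, with the value `0` for `s = +∞`. -/
def dualRateLimit (κ : ℝ) (s : EReal) : ℝ :=
  if s = ⊤ then 0 else κ * (κ ^ 2 + s.toReal ^ 2) ^ (-(1 / 2) : ℝ)

/-- `κ / s`, with the value `0` for `s = +∞`. -/
def primalRateLimit (κ : ℝ) (s : EReal) : ℝ :=
  if s = ⊤ then 0 else κ / s.toReal

end

section Subgradients

variable {E : Type*} [NormedAddCommGroup E] [InnerProductSpace ℝ E]

/-- A real bounded by `C t` for all small positive `t` is nonpositive. -/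
theorem nonpos_of_forall_le_mul {a C : ℝ} (h : ∀ t : ℝ, 0 < t → t ≤ 1 → a ≤ C * t) : a ≤ 0 := by
  have h1 : Tendsto (fun t : ℝ => C * t) (𝓝[>] 0) (𝓝 0) := by
    have : Tendsto (fun t : ℝ => C * t) (𝓝 0) (𝓝 (C * 0)) := (continuous_const_mul C).tendsto 0
    rw [mul_zero] at this
    exact this.mono_left nhdsWithin_le_nhds
  refine ge_of_tendsto h1 ?_
  filter_upwards [Ioc_mem_nhdsGT (zero_lt_one' ℝ)] with t ht using h t ht.1 ht.2

/-- The subdifferential of a function with quadratic upper and affine lower bounds of the same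
slope `g` is `{g}`. -/
theorem subdiff_eq_singleton {f : E → ℝ} {x g : E} {C : ℝ} (hl : g ∈ subdiff f x)
    (hu : ∀ d, f (x + d) ≤ f x + inner ℝ g d + C * ‖d‖ ^ 2) : subdiff f x = {g} := by
  refine Set.eq_singleton_iff_unique_mem.2 ⟨hl, fun v hv => ?_⟩
  have key : ‖v - g‖ ^ 2 ≤ 0 := by
    refine nonpos_of_forall_le_mul (C := C * ‖v - g‖ ^ 2) fun t ht _ => ?_
    have h1 := hv (x + t • (v - g))
    have h2 := hu (t • (v - g))
    rw [add_sub_cancel_left] at h1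
    have h3 : inner ℝ v (t • (v - g)) - inner ℝ g (t • (v - g)) = t * ‖v - g‖ ^ 2 := by
      rw [← inner_sub_left, inner_smul_right, real_inner_self_eq_norm_sq]
    have h4 : ‖t • (v - g)‖ ^ 2 = t ^ 2 * ‖v - g‖ ^ 2 := by
      rw [norm_smul, mul_pow, Real.norm_eq_abs, sq_abs]
    rw [h4] at h2
    refine le_of_mul_le_mul_left ?_ ht
    linarith
  have h0 : ‖v - g‖ = 0 := by nlinarith [norm_nonneg (v - g)]
  exact sub_eq_zero.1 (norm_eq_zero.1 h0)

/-- A subgradient of the sum of a strongly convex function `q` and a function `f` with a quadratic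
upper bound of slope `g`, minus `g`, is a subgradient of `q`, with a quadratic gain. -/
theorem StrongConvexOn.add_le_of_mem_subdiff_add {q f : E → ℝ} {a C : ℝ} {x g v : E}
    (hq : StrongConvexOn Set.univ a q)
    (hu : ∀ d, f (x + d) ≤ f x + inner ℝ g d + C * ‖d‖ ^ 2)
    (hv : v ∈ subdiff (fun x => f x + q x) x) (x' : E) :
    q x + inner ℝ (v - g) (x' - x) + a / 2 * ‖x' - x‖ ^ 2 ≤ q x' := by
  suffices h : q x + inner ℝ (v - g) (x' - x) + a / 2 * ‖x' - x‖ ^ 2 - q x' ≤ 0 by linarith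
  refine nonpos_of_forall_le_mul (C := (C + a / 2) * ‖x' - x‖ ^ 2) fun t ht ht1 => ?_
  have h1 := hv (x + t • (x' - x))
  have h2 := hu (t • (x' - x))
  have h3 := hq.2 (Set.mem_univ x) (Set.mem_univ x') (sub_nonneg.2 ht1) ht.le (by ring)
  have h4 : (1 - t) • x + t • x' = x + t • (x' - x) := by module
  have h5 : ‖t • (x' - x)‖ ^ 2 = t ^ 2 * ‖x' - x‖ ^ 2 := by
    rw [norm_smul, mul_pow, Real.norm_eq_abs, sq_abs]
  rw [h4, norm_sub_rev x x'] at h3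
  simp only [smul_eq_mul] at h3
  rw [h5, inner_smul_right] at h2
  rw [add_sub_cancel_left, inner_smul_right] at h1
  rw [inner_sub_left]
  refine le_of_mul_le_mul_left ?_ ht
  linarith

end Subgradients

namespace SparseSource

variable {m n : ℕ} (D : SparseSource m n)

theorem inner_VT (y : EuclideanSpace ℝ (Fin m)) (x : EuclideanSpace ℝ (Fin n)) :
    inner ℝ x (D.VT y) = inner ℝ (D.V x) y :=
  ContinuousLinearMap.adjoint_inner_right _ _ _

theorem inner_VT_left (y : EuclideanSpace ℝ (Fin m)) (x : EuclideanSpace ℝ (Fin n)) :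
    inner ℝ (D.VT y) x = inner ℝ y (D.V x) :=
  ContinuousLinearMap.adjoint_inner_left _ _ _

/-! ### The regularizer -/

theorem continuous_p : Continuous D.p := by
  unfold p; fun_prop

theorem strongConvexOn_p : StrongConvexOn Set.univ D.α₀ D.p := by
  rw [strongConvexOn_iff_convex]
  have h1 : (fun x => D.p x - D.α₀ / 2 * ‖x‖ ^ 2) = fun x => D.α * ∑ i, |x i| := by
    funext x; simp [p]
  rw [h1]
  refine ⟨convex_univ, fun x _ y _ a b ha hb _ => ?_⟩
  simp only [smul_eq_mul, PiLp.add_apply, PiLp.smul_apply]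
  have h2 : ∑ i, |a * x i + b * y i| ≤ ∑ i, (a * |x i| + b * |y i|) := by
    refine Finset.sum_le_sum fun i _ => (abs_add_le _ _).trans ?_
    rw [abs_mul, abs_mul, abs_of_nonneg ha, abs_of_nonneg hb]
  rw [Finset.sum_add_distrib, ← Finset.mul_sum, ← Finset.mul_sum] at h2
  have h3 := mul_le_mul_of_nonneg_left h2 D.α_pos.le
  linarith

theorem p_add_le_of_mem_subdiff {x z : EuclideanSpace ℝ (Fin n)} (hz : z ∈ subdiff D.p x)
    (x' : EuclideanSpace ℝ (Fin n)) :
    D.p x + inner ℝ z (x' - x) + D.α₀ / 2 * ‖x' - x‖ ^ 2 ≤ D.p x' := by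
  have h := D.strongConvexOn_p.add_le_of_mem_subdiff_add (f := fun _ => 0) (g := 0) (C := 0)
    (x := x) (v := z) (by simp) (by simpa using hz) x'
  simpa using h

/-- Strong monotonicity of `∂p`. -/
theorem mul_norm_sq_le_inner_of_mem_subdiff {x z x' z' : EuclideanSpace ℝ (Fin n)}
    (hz : z ∈ subdiff D.p x) (hz' : z' ∈ subdiff D.p x') :
    D.α₀ * ‖x - x'‖ ^ 2 ≤ inner ℝ (z - z') (x - x') := by
  have h1 := D.p_add_le_of_mem_subdiff hz x'
  have h2 := D.p_add_le_of_mem_subdiff hz' x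
  rw [← neg_sub x x', norm_neg, inner_neg_right] at h1
  rw [inner_sub_left]
  linarith

/-- The inclusion `-g x ∈ ∂p x` is solvable if `g` is the gradient of a convex function `f` with
quadratic upper bounds. -/
theorem exists_neg_mem_subdiff_p {f : EuclideanSpace ℝ (Fin n) → ℝ}
    {g : EuclideanSpace ℝ (Fin n) → EuclideanSpace ℝ (Fin n)} {C : ℝ} (hf : Continuous f)
    (hl : ∀ x, f 0 + inner ℝ (g 0) x ≤ f x)
    (hu : ∀ x d, f (x + d) ≤ f x + inner ℝ (g x) d + C * ‖d‖ ^ 2) :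
    ∃ x, -g x ∈ subdiff D.p x := by
  have h0 := D.α₀_pos
  have hlow : ∀ x, f 0 + (-‖g 0‖ + D.α₀ / 2 * ‖x‖) * ‖x‖ ≤ f x + D.p x := fun x => by
    have h1 := hl x
    have h2 := neg_le_of_abs_le (abs_real_inner_le_norm (g 0) x)
    have h3 : 0 ≤ D.α * ∑ i, |x i| :=
      mul_nonneg D.α_pos.le (Finset.sum_nonneg fun i _ => abs_nonneg _)
    simp only [p]
    nlinarith
  have hcoer : Tendsto (fun x => f x + D.p x) (cocompact _) atTop := by
    refine tendsto_atTop_mono hlow (tendsto_atTop_add_const_left _ _ ?_)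
    have hn := tendsto_norm_cocompact_atTop (E := EuclideanSpace ℝ (Fin n))
    exact (tendsto_atTop_add_const_left _ _ (hn.const_mul_atTop (by positivity))).atTop_mul_atTop₀ hn
  obtain ⟨x, hx⟩ := (hf.add D.continuous_p).exists_forall_le hcoer
  refine ⟨x, fun x' => ?_⟩
  have h := D.strongConvexOn_p.add_le_of_mem_subdiff_add (v := 0) (hu x)
    (fun x' => by simpa using hx x') x'
  rw [zero_sub] at h
  have : 0 ≤ D.α₀ / 2 * ‖x' - x‖ ^ 2 := by positivity
  linarith

/-! ### The data term -/

/-- The gradient of `μ ↦ h (V μ)`. -/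
noncomputable def gradData (x : EuclideanSpace ℝ (Fin n)) : EuclideanSpace ℝ (Fin n) := D.VT (D.V x - D.ub)

theorem h_add (x d : EuclideanSpace ℝ (Fin n)) :
    D.h (D.V (x + d)) = D.h (D.V x) + inner ℝ (D.gradData x) d + 1 / 2 * ‖D.V d‖ ^ 2 := by
  simp only [h, gradData, inner_VT_left, map_add]
  rw [show D.V x + D.V d - D.ub = (D.V x - D.ub) + D.V d by abel, norm_add_sq_real]
  ring

theorem norm_V_sq_le (d : EuclideanSpace ℝ (Fin n)) : ‖D.V d‖ ^ 2 ≤ ‖D.V‖ ^ 2 * ‖d‖ ^ 2 := by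
  rw [← mul_pow]
  gcongr
  exact D.V.le_opNorm d

theorem continuous_h_V : Continuous fun x => D.h (D.V x) := by
  unfold h; fun_prop

theorem gradData_sub (x x' : EuclideanSpace ℝ (Fin n)) :
    D.gradData x - D.gradData x' = D.VT (D.V (x - x')) := by
  simp [gradData, map_sub]

/-! ### The primal objective and its proximal mapping -/

theorem mem_subdiff_primal_iff {x v : EuclideanSpace ℝ (Fin n)} :
    v ∈ subdiff D.primal x ↔ v - D.gradData x ∈ subdiff D.p x := by
  constructor
  · intro hv x'
    have h := D.strongConvexOn_p.add_le_of_mem_subdiff_add (f := fun x => D.h (D.V x))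
      (g := D.gradData x) (C := 1 / 2 * ‖D.V‖ ^ 2) (x := x) (v := v) (fun d => by
        rw [D.h_add]; linarith [D.norm_V_sq_le d]) hv x'
    have h0 := D.α₀_pos
    have : 0 ≤ D.α₀ / 2 * ‖x' - x‖ ^ 2 := by positivity
    linarith
  · intro hv x'
    have h1 := hv x'
    have h2 := D.h_add x (x' - x)
    rw [add_sub_cancel] at h2
    rw [inner_sub_left] at h1
    simp only [primal]
    linarith [sq_nonneg ‖D.V (x' - x)‖]

theorem mem_solutionSet_iff {x : EuclideanSpace ℝ (Fin n)} :
    x ∈ D.solutionSet ↔ 0 ∈ subdiff D.primal x := by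
  simp [solutionSet, subdiff]

/-- Strong monotonicity of `∂P`. -/
theorem mul_norm_sq_le_inner_of_mem_subdiff_primal {x v x' v' : EuclideanSpace ℝ (Fin n)}
    (hv : v ∈ subdiff D.primal x) (hv' : v' ∈ subdiff D.primal x') :
    D.α₀ * ‖x - x'‖ ^ 2 ≤ inner ℝ (v - v') (x - x') := by
  have h1 := D.mul_norm_sq_le_inner_of_mem_subdiff (D.mem_subdiff_primal_iff.1 hv)
    (D.mem_subdiff_primal_iff.1 hv')
  rw [show v - D.gradData x - (v' - D.gradData x') =
    (v - v') - (D.gradData x - D.gradData x') by abel, D.gradData_sub, inner_sub_left (v - v'),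
    inner_VT_left, real_inner_self_eq_norm_sq] at h1
  linarith [sq_nonneg ‖D.V (x - x')‖]

theorem mul_norm_le_of_mem_subdiff_primal {x v x' : EuclideanSpace ℝ (Fin n)}
    (hv : v ∈ subdiff D.primal x) (hx' : 0 ∈ subdiff D.primal x') : D.α₀ * ‖x - x'‖ ≤ ‖v‖ := by
  have h1 := D.mul_norm_sq_le_inner_of_mem_subdiff_primal hv hx'
  have h2 := real_inner_le_norm (v - 0) (x - x')
  rw [sub_zero] at h1 h2
  rcases (norm_nonneg (x - x')).eq_or_lt with h | h
  · rw [← h, mul_zero]; exact norm_nonneg _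
  · refine le_of_mul_le_mul_right ?_ h
    linarith

theorem exists_zero_mem_subdiff_primal : ∃ x, (0 : EuclideanSpace ℝ (Fin n)) ∈ subdiff D.primal x := by
  obtain ⟨x, hx⟩ := D.exists_neg_mem_subdiff_p (f := fun x => D.h (D.V x)) (g := D.gradData)
    (C := 1 / 2 * ‖D.V‖ ^ 2) D.continuous_h_V
    (fun x => by
      have := D.h_add 0 x
      rw [zero_add] at this
      linarith [sq_nonneg ‖D.V x‖])
    (fun x d => by rw [D.h_add]; linarith [D.norm_V_sq_le d])
  exact ⟨x, D.mem_subdiff_primal_iff.2 (by rwa [zero_sub])⟩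

theorem solutionSet_eq_singleton {x : EuclideanSpace ℝ (Fin n)}
    (hx : 0 ∈ subdiff D.primal x) : D.solutionSet = {x} := by
  refine Set.eq_singleton_iff_unique_mem.2 ⟨D.mem_solutionSet_iff.2 hx, fun x' hx' => ?_⟩
  have h := D.mul_norm_le_of_mem_subdiff_primal (D.mem_solutionSet_iff.1 hx') hx
  rw [norm_zero] at h
  have h0 := D.α₀_pos
  have : ‖x' - x‖ = 0 := by nlinarith [norm_nonneg (x' - x)]
  exact sub_eq_zero.1 (norm_eq_zero.1 this)

/-- The proximal mapping of `P` is defined everywhere. -/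
theorem exists_prox {σ : ℝ} (hσ : 0 < σ) (μ : EuclideanSpace ℝ (Fin n)) :
    ∃ x, σ⁻¹ • (μ - x) ∈ subdiff D.primal x := by
  have hexp : ∀ x d : EuclideanSpace ℝ (Fin n),
      D.h (D.V (x + d)) + σ⁻¹ / 2 * ‖x + d - μ‖ ^ 2 =
        D.h (D.V x) + σ⁻¹ / 2 * ‖x - μ‖ ^ 2 + inner ℝ (D.gradData x + σ⁻¹ • (x - μ)) d +
          (1 / 2 * ‖D.V d‖ ^ 2 + σ⁻¹ / 2 * ‖d‖ ^ 2) := fun x d => by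
    rw [D.h_add, show x + d - μ = (x - μ) + d by abel, norm_add_sq_real, inner_add_left,
      real_inner_smul_left]
    ring
  obtain ⟨x, hx⟩ := D.exists_neg_mem_subdiff_p
    (f := fun x => D.h (D.V x) + σ⁻¹ / 2 * ‖x - μ‖ ^ 2)
    (g := fun x => D.gradData x + σ⁻¹ • (x - μ)) (C := 1 / 2 * ‖D.V‖ ^ 2 + σ⁻¹ / 2)
    (D.continuous_h_V.add (by fun_prop))
    (fun x => by
      have := hexp 0 x
      rw [zero_add] at this
      rw [this]
      have : 0 ≤ 1 / 2 * ‖D.V x‖ ^ 2 + σ⁻¹ / 2 * ‖x‖ ^ 2 := by positivity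
      linarith)
    (fun x d => by
      simp only [hexp]
      linarith [D.norm_V_sq_le d])
  refine ⟨x, D.mem_subdiff_primal_iff.2 ?_⟩
  convert hx using 1
  module

/-- Firm nonexpansiveness of the proximal mapping, with the gain from strong convexity. -/
theorem prox_sq_le {σ : ℝ} (hσ : 0 < σ) {μ x xbar : EuclideanSpace ℝ (Fin n)}
    (hx : σ⁻¹ • (μ - x) ∈ subdiff D.primal x) (hxbar : 0 ∈ subdiff D.primal xbar) :
    (1 + 2 * σ * D.α₀) * ‖x - xbar‖ ^ 2 + ‖μ - x‖ ^ 2 ≤ ‖μ - xbar‖ ^ 2 := by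
  have h1 := D.mul_norm_sq_le_inner_of_mem_subdiff_primal hx hxbar
  rw [sub_zero, real_inner_smul_left] at h1
  have h2 : σ * (D.α₀ * ‖x - xbar‖ ^ 2) ≤ inner ℝ (μ - x) (x - xbar) := by
    have := mul_le_mul_of_nonneg_left h1 hσ.le
    rwa [mul_inv_cancel_left₀ hσ.ne'] at this
  have h3 : ‖μ - xbar‖ ^ 2 = ‖μ - x‖ ^ 2 + 2 * inner ℝ (μ - x) (x - xbar) + ‖x - xbar‖ ^ 2 := by
    rw [← norm_add_sq_real]; congr 2; abel
  linarith

/-- The proximal mapping contracts towards the minimizer. -/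
theorem prox_contract {σ : ℝ} (hσ : 0 < σ) {μ x xbar : EuclideanSpace ℝ (Fin n)}
    (hx : σ⁻¹ • (μ - x) ∈ subdiff D.primal x) (hxbar : 0 ∈ subdiff D.primal xbar) :
    (1 + σ * D.α₀) * ‖x - xbar‖ ≤ ‖μ - xbar‖ := by
  have h1 := D.mul_norm_le_of_mem_subdiff_primal hx hxbar
  have h0 := D.prox_sq_le hσ hx hxbar
  rw [norm_smul, norm_inv, Real.norm_of_nonneg hσ.le, ← div_eq_inv_mul, le_div_iff₀ hσ] at h1
  have hα := mul_pos hσ D.α₀_pos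
  refine abs_le_of_sq_le_sq' ?_ (norm_nonneg _) |>.2
  have h2 : (σ * D.α₀ * ‖x - xbar‖) ^ 2 ≤ ‖μ - x‖ ^ 2 := by
    gcongr; linarith
  nlinarith

/-! ### The conjugate functions -/

theorem hStar_eq (v : EuclideanSpace ℝ (Fin m)) :
    D.hStar v = 1 / 2 * ‖v‖ ^ 2 + inner ℝ D.ub v := by
  refine le_antisymm (ciSup_le fun x => ?_) ?_
  · have h1 : inner ℝ x v = inner ℝ (x - D.ub) v + inner ℝ D.ub v := by
      rw [inner_sub_left]; ring
    have h2 := real_inner_le_norm (x - D.ub) v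
    simp only [h]
    nlinarith [sq_nonneg (‖x - D.ub‖ - ‖v‖)]
  · refine le_trans (le_of_eq ?_) (le_ciSup (D.bddAbove_h v) (v + D.ub))
    simp only [h, inner_add_left, real_inner_self_eq_norm_sq, add_sub_cancel_right]
    ring

theorem hStar_add (y d : EuclideanSpace ℝ (Fin m)) :
    D.hStar (y + d) = D.hStar y + inner ℝ (y + D.ub) d + 1 / 2 * ‖d‖ ^ 2 := by
  simp only [hStar_eq, norm_add_sq_real, inner_add_left, inner_add_right]
  ring

theorem le_pStar (x z : EuclideanSpace ℝ (Fin n)) : inner ℝ x z - D.p x ≤ D.pStar z :=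
  le_ciSup (D.bddAbove_p z) x

theorem pStar_eq {x z : EuclideanSpace ℝ (Fin n)} (hz : z ∈ subdiff D.p x) :
    D.pStar z = inner ℝ x z - D.p x := by
  refine le_antisymm (ciSup_le fun x' => ?_) (D.le_pStar x z)
  have := hz x'
  rw [inner_sub_right, real_inner_comm, real_inner_comm x z] at this
  linarith

theorem exists_mem_subdiff_p (z : EuclideanSpace ℝ (Fin n)) : ∃ x, z ∈ subdiff D.p x := by
  obtain ⟨x, hx⟩ := D.exists_neg_mem_subdiff_p (f := fun x => -inner ℝ z x) (g := fun _ => -z)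
    (C := 0) (by fun_prop) (by simp) (fun x d => by
      simp only [inner_add_right, inner_neg_left]; linarith)
  exact ⟨x, by simpa using hx⟩

theorem pStar_lower {x z : EuclideanSpace ℝ (Fin n)} (hz : z ∈ subdiff D.p x)
    (d : EuclideanSpace ℝ (Fin n)) : D.pStar z + inner ℝ x d ≤ D.pStar (z + d) := by
  have h1 := D.le_pStar x (z + d)
  rw [D.pStar_eq hz]
  rw [inner_add_right] at h1
  linarith

theorem pStar_upper {x z : EuclideanSpace ℝ (Fin n)} (hz : z ∈ subdiff D.p x)
    (d : EuclideanSpace ℝ (Fin n)) :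
    D.pStar (z + d) ≤ D.pStar z + inner ℝ x d + 1 / (2 * D.α₀) * ‖d‖ ^ 2 := by
  have h0 := D.α₀_pos
  refine ciSup_le fun x' => ?_
  have h1 := D.p_add_le_of_mem_subdiff hz x'
  have h2 := real_inner_le_norm (x' - x) d
  have h3 : ‖x' - x‖ * ‖d‖ ≤ D.α₀ / 2 * ‖x' - x‖ ^ 2 + 1 / (2 * D.α₀) * ‖d‖ ^ 2 := by
    have : D.α₀ / 2 * ‖x' - x‖ ^ 2 + 1 / (2 * D.α₀) * ‖d‖ ^ 2 - ‖x' - x‖ * ‖d‖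
        = (D.α₀ * ‖x' - x‖ - ‖d‖) ^ 2 / (2 * D.α₀) := by field_simp; ring
    have h5 : 0 ≤ (D.α₀ * ‖x' - x‖ - ‖d‖) ^ 2 / (2 * D.α₀) := by positivity
    linarith
  rw [D.pStar_eq hz, inner_add_right]
  rw [inner_sub_right, real_inner_comm, real_inner_comm x z] at h1
  rw [inner_sub_left] at h2
  linarith

/-! ### The Lagrangian and the augmented Lagrangian -/

theorem norm_mkYZ_sq (y : EuclideanSpace ℝ (Fin m)) (z : EuclideanSpace ℝ (Fin n)) :
    ‖mkYZ y z‖ ^ 2 = ‖y‖ ^ 2 + ‖z‖ ^ 2 :=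
  WithLp.prod_norm_sq_eq_of_L2 _

theorem norm_mkYZL_sq (y : EuclideanSpace ℝ (Fin m)) (z lam : EuclideanSpace ℝ (Fin n)) :
    ‖mkYZL y z lam‖ ^ 2 = ‖mkYZ y z‖ ^ 2 + ‖lam‖ ^ 2 :=
  WithLp.prod_norm_sq_eq_of_L2 _

theorem lag_lower {y : EuclideanSpace ℝ (Fin m)} {z x : EuclideanSpace ℝ (Fin n)}
    (hz : z ∈ subdiff D.p x) (lam : EuclideanSpace ℝ (Fin n)) (d : EuclideanSpace ℝ (Fin m))
    (e : EuclideanSpace ℝ (Fin n)) :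
    D.lag y z lam + inner ℝ (y + D.ub + D.V lam) d + inner ℝ (x + lam) e ≤
      D.lag (y + d) (z + e) lam := by
  have h1 := D.pStar_lower hz e
  simp only [lag, hStar_add, map_add, inner_add_right, inner_add_left, inner_VT] at *
  linarith [sq_nonneg ‖d‖]

theorem lag_upper {y : EuclideanSpace ℝ (Fin m)} {z x : EuclideanSpace ℝ (Fin n)}
    (hz : z ∈ subdiff D.p x) (lam : EuclideanSpace ℝ (Fin n)) (d : EuclideanSpace ℝ (Fin m))
    (e : EuclideanSpace ℝ (Fin n)) :
    D.lag (y + d) (z + e) lam ≤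
      D.lag y z lam + inner ℝ (y + D.ub + D.V lam) d + inner ℝ (x + lam) e +
        (1 / 2 * ‖d‖ ^ 2 + 1 / (2 * D.α₀) * ‖e‖ ^ 2) := by
  have h1 := D.pStar_upper hz e
  simp only [lag, hStar_add, map_add, inner_add_right, inner_add_left, inner_VT] at *
  linarith

theorem augLag_add (σ : ℝ) (y d : EuclideanSpace ℝ (Fin m))
    (z e lam : EuclideanSpace ℝ (Fin n)) :
    D.augLag σ (y + d) (z + e) lam = D.augLag σ y z lam +
      (D.lag (y + d) (z + e) (lam + σ • (D.VT y + z)) - D.lag y z (lam + σ • (D.VT y + z))) +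
      σ / 2 * ‖D.VT d + e‖ ^ 2 := by
  have h1 : D.VT (y + d) + (z + e) = (D.VT y + z) + (D.VT d + e) := by rw [map_add]; abel
  simp only [augLag, lag]
  rw [h1]
  generalize D.VT y + z = u
  generalize D.VT d + e = u'
  simp only [norm_add_sq_real, inner_add_left, inner_add_right, real_inner_smul_left]
  ring

theorem inner_mkYZ (y y' : EuclideanSpace ℝ (Fin m)) (z z' : EuclideanSpace ℝ (Fin n)) :
    inner ℝ (mkYZ y z) (mkYZ y' z') = inner ℝ y y' + inner ℝ z z' :=
  WithLp.prod_inner_apply _ _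

theorem exists_eq_mkYZ_add (y : EuclideanSpace ℝ (Fin m)) (z : EuclideanSpace ℝ (Fin n))
    (w : YZ m n) : ∃ d e, w = mkYZ (y + d) (z + e) ∧ w - mkYZ y z = mkYZ d e :=
  ⟨w.fst - y, w.snd - z, by rw [add_sub_cancel, add_sub_cancel]; rfl, rfl⟩

theorem subdiff_lag {z x : EuclideanSpace ℝ (Fin n)} (y : EuclideanSpace ℝ (Fin m))
    (hz : z ∈ subdiff D.p x) (lam : EuclideanSpace ℝ (Fin n)) :
    subdiff (fun w : YZ m n => D.lag w.fst w.snd lam) (mkYZ y z) =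
      {mkYZ (y + D.ub + D.V lam) (x + lam)} := by
  have h0 := D.α₀_pos
  refine subdiff_eq_singleton (C := 1 / 2 + 1 / (2 * D.α₀)) (fun w => ?_) (fun w => ?_)
  · obtain ⟨d, e, rfl, hw⟩ := exists_eq_mkYZ_add y z w
    rw [hw, inner_mkYZ, ← add_assoc]
    exact D.lag_lower hz lam d e
  · obtain ⟨d, e, rfl⟩ : ∃ d e, w = mkYZ d e := ⟨w.fst, w.snd, rfl⟩
    have h := D.lag_upper (y := y) hz lam d e
    have h2 : 0 ≤ 1 / (2 * D.α₀) * ‖d‖ ^ 2 := by positivity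
    rw [inner_mkYZ, norm_mkYZ_sq]
    change D.lag (y + d) (z + e) lam ≤ D.lag y z lam + _ + _
    linarith [sq_nonneg ‖e‖]

theorem subdiff_augLag {σ : ℝ} (hσ : 0 < σ) {z x : EuclideanSpace ℝ (Fin n)}
    (y : EuclideanSpace ℝ (Fin m)) (hz : z ∈ subdiff D.p x) (lam : EuclideanSpace ℝ (Fin n)) :
    subdiff (fun w : YZ m n => D.augLag σ w.fst w.snd lam) (mkYZ y z) =
      {mkYZ (y + D.ub + D.V (lam + σ • (D.VT y + z))) (x + (lam + σ • (D.VT y + z)))} := by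
  have h0 := D.α₀_pos
  refine subdiff_eq_singleton (C := 1 / 2 + 1 / (2 * D.α₀) + σ * (‖D.VT‖ ^ 2 + 1))
    (fun w => ?_) (fun w => ?_)
  · obtain ⟨d, e, rfl, hw⟩ := exists_eq_mkYZ_add y z w
    have h := D.lag_lower (y := y) hz (lam + σ • (D.VT y + z)) d e
    have h3 := D.augLag_add σ y d z e lam
    have h4 : 0 ≤ σ / 2 * ‖D.VT d + e‖ ^ 2 := by positivity
    rw [hw, inner_mkYZ]
    change D.augLag σ y z lam + _ ≤ D.augLag σ (y + d) (z + e) lam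
    linarith
  · obtain ⟨d, e, rfl⟩ : ∃ d e, w = mkYZ d e := ⟨w.fst, w.snd, rfl⟩
    have h := D.lag_upper (y := y) hz (lam + σ • (D.VT y + z)) d e
    have h3 := D.augLag_add σ y d z e lam
    have h2 : 0 ≤ 1 / (2 * D.α₀) * ‖d‖ ^ 2 := by positivity
    have h4 : ‖D.VT d + e‖ ^ 2 ≤ 2 * (‖D.VT‖ ^ 2 + 1) * (‖d‖ ^ 2 + ‖e‖ ^ 2) := by
      have h5 : ‖D.VT d + e‖ ≤ ‖D.VT‖ * ‖d‖ + ‖e‖ :=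
        (norm_add_le _ _).trans (by gcongr; exact D.VT.le_opNorm _)
      have h6 := pow_le_pow_left₀ (norm_nonneg _) h5 2
      nlinarith [sq_nonneg (‖D.VT‖ * ‖d‖ - ‖e‖), sq_nonneg (‖D.VT‖ * ‖e‖), sq_nonneg ‖d‖]
    have h5 := mul_le_mul_of_nonneg_left h4 (half_pos hσ).le
    rw [inner_mkYZ, norm_mkYZ_sq]
    change D.augLag σ (y + d) (z + e) lam ≤ D.augLag σ y z lam + _ + _
    linarith [sq_nonneg ‖e‖]

theorem Tl_eq {z x : EuclideanSpace ℝ (Fin n)} (y : EuclideanSpace ℝ (Fin m))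
    (hz : z ∈ subdiff D.p x) (lam : EuclideanSpace ℝ (Fin n)) :
    D.Tl (mkYZL y z lam) = {mkYZL (y + D.ub + D.V lam) (x + lam) (-(D.VT y + z))} := by
  have h1 := D.subdiff_lag y hz lam
  have h2 : subdiff (fun lam => -D.lag y z lam) lam = {-(D.VT y + z)} := by
    refine subdiff_eq_singleton (C := 0) (fun lam' => ?_) (fun d => ?_)
    · simp only [lag, inner_neg_left, inner_sub_right, real_inner_comm _ (D.VT y + z)]
      linarith
    · simp only [lag, inner_neg_left, inner_add_left, real_inner_comm _ (D.VT y + z)]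
      linarith
  ext v
  change v.fst ∈ subdiff (fun w : YZ m n => D.lag w.fst w.snd lam) (mkYZ y z) ∧
    v.snd ∈ subdiff (fun lam => -D.lag y z lam) lam ↔ _
  rw [h1, h2]
  constructor
  · rintro ⟨h3, h4⟩
    exact (WithLp.ofLp_injective 2) (Prod.ext h3 h4)
  · rintro rfl
    exact ⟨rfl, rfl⟩

/-! ### The KKT point -/

/-- The `y`-component of the KKT point that belongs to the primal solution `x`. -/
noncomputable def dualY (x : EuclideanSpace ℝ (Fin n)) : EuclideanSpace ℝ (Fin m) := D.V x - D.ub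

theorem neg_VT_dualY_mem {x : EuclideanSpace ℝ (Fin n)} (hx : 0 ∈ subdiff D.primal x) :
    -D.VT (D.dualY x) ∈ subdiff D.p x := by
  have := D.mem_subdiff_primal_iff.1 hx
  rwa [zero_sub] at this

theorem isKKT_of_mem {x : EuclideanSpace ℝ (Fin n)} (hx : 0 ∈ subdiff D.primal x) :
    D.IsKKT (D.dualY x) (-D.VT (D.dualY x)) (-x) := by
  refine ⟨fun y' => ?_, fun z' => ?_, by simp⟩
  · have h := D.hStar_add (D.dualY x) (y' - D.dualY x)
    rw [add_sub_cancel, show D.dualY x + D.ub = D.V x by simp [dualY]] at h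
    rw [map_neg, neg_neg]
    linarith [sq_nonneg ‖y' - D.dualY x‖]
  · have h := D.pStar_lower (D.neg_VT_dualY_mem hx) (z' - -D.VT (D.dualY x))
    rw [add_sub_cancel] at h
    rwa [neg_neg]

theorem Tl_kkt {x : EuclideanSpace ℝ (Fin n)} (hx : 0 ∈ subdiff D.primal x) :
    D.Tl (mkYZL (D.dualY x) (-D.VT (D.dualY x)) (-x)) = {0} := by
  rw [D.Tl_eq _ (D.neg_VT_dualY_mem hx)]
  have h1 : D.dualY x + D.ub + D.V (-x) = 0 := by simp [dualY]
  rw [h1, add_neg_cancel, add_neg_cancel, neg_zero]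
  rfl

theorem le_mul_of_quadratic_bounds {α a b c q M N X : ℝ} (hα : 0 < α) (hN : 0 ≤ N) (hX : 0 ≤ X)
    (hXsq : X ^ 2 = a ^ 2 + b ^ 2 + c ^ 2) (h : a ^ 2 + α * q ^ 2 ≤ N * X) (hc : c ≤ N + q)
    (hb : b ≤ N + M * a) (hb0 : 0 ≤ b) (hc0 : 0 ≤ c) :
    X ≤ (1 + 2 * M ^ 2 + 2 / α + 4) * N := by
  have h5 : c ^ 2 ≤ 2 * N ^ 2 + 2 * q ^ 2 := by
    linarith [pow_le_pow_left₀ hc0 hc 2, sq_nonneg (N - q)]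
  have h6 : b ^ 2 ≤ 2 * N ^ 2 + 2 * M ^ 2 * a ^ 2 := by
    linarith [pow_le_pow_left₀ hb0 hb 2, sq_nonneg (N - M * a)]
  have h8 : a ^ 2 ≤ N * X := by linarith [mul_nonneg hα.le (sq_nonneg q)]
  have h9 : 2 * q ^ 2 ≤ 2 / α * (N * X) := by
    rw [div_mul_eq_mul_div, le_div_iff₀ hα]
    linarith [sq_nonneg a]
  have h10 : (1 + 2 * M ^ 2) * a ^ 2 ≤ (1 + 2 * M ^ 2) * (N * X) := by gcongr
  set B := 1 + 2 * M ^ 2 + 2 / α with hB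
  have hB0 : 0 ≤ B := by positivity
  have h11 : X ^ 2 ≤ B * (N * X) + 4 * N ^ 2 := by rw [hXsq, hB]; linarith
  by_contra! hcon
  have h12 : N ≤ X := by linarith [mul_nonneg hB0 hN]
  have h13 : 0 < X := lt_of_le_of_lt (by positivity) hcon
  linarith [mul_lt_mul_of_pos_right hcon h13, mul_le_mul_of_nonneg_left h12 hN]

/-- A global error bound for `T_l` at the KKT point. -/
theorem exists_norm_le_Tl {xbar : EuclideanSpace ℝ (Fin n)} (hx : 0 ∈ subdiff D.primal xbar) :
    ∃ K : ℝ, 0 ≤ K ∧ ∀ x v, v ∈ D.Tl x →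
      ‖x - mkYZL (D.dualY xbar) (-D.VT (D.dualY xbar)) (-xbar)‖ ≤ K * ‖v‖ := by
  have h0 := D.α₀_pos
  refine ⟨1 + 2 * ‖D.VT‖ ^ 2 + 2 / D.α₀ + 4, by positivity, fun x v hv => ?_⟩
  obtain ⟨y, z, lam, rfl⟩ : ∃ y z lam, x = mkYZL y z lam := ⟨x.fst.fst, x.fst.snd, x.snd, rfl⟩
  obtain ⟨g, hg⟩ := D.exists_mem_subdiff_p z
  rw [D.Tl_eq y hg lam, Set.mem_singleton_iff] at hv
  have hmono := D.mul_norm_sq_le_inner_of_mem_subdiff hg (D.neg_VT_dualY_mem hx)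
  set a := y - D.dualY xbar with ha
  set b := z - -D.VT (D.dualY xbar) with hb
  set c := lam - -xbar with hc
  set q := g - xbar with hq
  have hdiff : mkYZL y z lam - mkYZL (D.dualY xbar) (-D.VT (D.dualY xbar)) (-xbar) =
    mkYZL a b c := rfl
  have hv' : v = mkYZL (a + D.V c) (q + c) (-(D.VT a + b)) := by
    rw [hv]
    congr 1
    · simp only [ha, hc, dualY, map_sub, map_neg]; abel
    · simp only [hq, hc]; abel
    · simp only [ha, hb, map_sub]; abel
  rw [hdiff]
  clear_value a b c q
  have hN := norm_nonneg v
  have hinner : inner ℝ v (mkYZL a b c) = ‖a‖ ^ 2 + inner ℝ b q := by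
    rw [hv', WithLp.prod_inner_apply]
    change inner ℝ (mkYZ _ _) (mkYZ a b) + inner ℝ (-(D.VT a + b)) c = _
    rw [WithLp.prod_inner_apply]
    change inner ℝ (a + D.V c) a + inner ℝ (q + c) b + _ = _
    simp only [inner_add_left, inner_neg_left, real_inner_self_eq_norm_sq, inner_VT_left,
      real_inner_comm q b, real_inner_comm c b, real_inner_comm (D.V c) a]
    ring
  have hCS := real_inner_le_norm v (mkYZL a b c)
  have hvsq : ‖v‖ ^ 2 = ‖a + D.V c‖ ^ 2 + ‖q + c‖ ^ 2 + ‖D.VT a + b‖ ^ 2 := by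
    rw [hv', norm_mkYZL_sq, norm_mkYZ_sq, norm_neg]
  have hXsq : ‖mkYZL a b c‖ ^ 2 = ‖a‖ ^ 2 + ‖b‖ ^ 2 + ‖c‖ ^ 2 := by
    rw [norm_mkYZL_sq, norm_mkYZ_sq]
  have hX := norm_nonneg (mkYZL a b c)
  generalize ‖mkYZL a b c‖ = X at *
  have h1 : ‖q + c‖ ≤ ‖v‖ := by
    refine abs_le_of_sq_le_sq' ?_ hN |>.2
    linarith [sq_nonneg ‖a + D.V c‖, sq_nonneg ‖D.VT a + b‖]
  have h2 : ‖D.VT a + b‖ ≤ ‖v‖ := by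
    refine abs_le_of_sq_le_sq' ?_ hN |>.2
    linarith [sq_nonneg ‖a + D.V c‖, sq_nonneg ‖q + c‖]
  have h3 : ‖c‖ ≤ ‖v‖ + ‖q‖ := by
    have := norm_sub_le (q + c) q
    rw [add_sub_cancel_left] at this
    linarith
  have h4 : ‖b‖ ≤ ‖v‖ + ‖D.VT‖ * ‖a‖ := by
    have := norm_sub_le (D.VT a + b) (D.VT a)
    rw [add_sub_cancel_left] at this
    linarith [D.VT.le_opNorm a]
  refine le_mul_of_quadratic_bounds h0 hN hX hXsq ?_ h3 h4 (norm_nonneg b) (norm_nonneg c)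
  linarith

theorem Tl_inv_zero {xbar : EuclideanSpace ℝ (Fin n)} (hx : 0 ∈ subdiff D.primal xbar) :
    {x | 0 ∈ D.Tl x} = {mkYZL (D.dualY xbar) (-D.VT (D.dualY xbar)) (-xbar)} := by
  obtain ⟨K, -, hK⟩ := D.exists_norm_le_Tl hx
  refine Set.eq_singleton_iff_unique_mem.2 ⟨?_, fun x hx' => ?_⟩
  · rw [Set.mem_ofPred_eq, D.Tl_kkt hx]; rfl
  · have := hK x 0 hx'
    rw [norm_zero, mul_zero] at this
    exact sub_eq_zero.1 (norm_le_zero_iff.1 this)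

/-! ### The optimality gap -/

theorem lag_ge (y : EuclideanSpace ℝ (Fin m)) (z x : EuclideanSpace ℝ (Fin n)) :
    -D.primal x + 1 / 2 * ‖y - D.dualY x‖ ^ 2 ≤ D.lag y z (-x) := by
  have h1 := D.le_pStar x z
  simp only [lag, primal, h, hStar_eq, inner_neg_left, inner_add_right, inner_VT, dualY]
  have h2 : ‖y - (D.V x - D.ub)‖ ^ 2 =
      ‖y‖ ^ 2 - 2 * inner ℝ y (D.V x - D.ub) + ‖D.V x - D.ub‖ ^ 2 := norm_sub_sq_real _ _
  rw [inner_sub_right, real_inner_comm, real_inner_comm D.ub y] at h2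
  linarith

theorem lag_eq {x z : EuclideanSpace ℝ (Fin n)} (hz : z ∈ subdiff D.p x) :
    D.lag (D.dualY x) z (-x) = -D.primal x := by
  simp only [lag, primal, h, hStar_eq, inner_neg_left, inner_add_right, inner_VT, D.pStar_eq hz]
  have h2 : ‖D.dualY x‖ ^ 2 = inner ℝ (D.V x) (D.dualY x) - inner ℝ D.ub (D.dualY x) := by
    rw [← inner_sub_left, ← real_inner_self_eq_norm_sq]; rfl
  change _ = -(1 / 2 * ‖D.dualY x‖ ^ 2 + D.p x)
  linarith

/-- The augmented Lagrangian as a maximum over the multiplier. -/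
theorem augLag_eq {σ : ℝ} (hσ : 0 < σ) (y : EuclideanSpace ℝ (Fin m))
    (z lam lam' : EuclideanSpace ℝ (Fin n)) :
    D.augLag σ y z lam = D.lag y z lam' - 1 / (2 * σ) * ‖lam' - lam‖ ^ 2 +
      1 / (2 * σ) * ‖lam + σ • (D.VT y + z) - lam'‖ ^ 2 := by
  simp only [augLag, lag]
  generalize D.VT y + z = u
  have h1 : lam + σ • u - lam' = σ • u - (lam' - lam) := by abel
  have h2 : inner ℝ lam' u = inner ℝ lam u + inner ℝ (lam' - lam) u := by
    rw [← inner_add_left, add_sub_cancel]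
  rw [h1, norm_sub_sq_real (σ • u), norm_smul, mul_pow, Real.norm_eq_abs, sq_abs, real_inner_smul_left,
    h2, real_inner_comm (lam' - lam) u]
  field_simp
  ring

/-- The optimality gap controls the distance of the new multiplier to the proximal point. -/
theorem le_gap {σ : ℝ} (hσ : 0 < σ) {lam x : EuclideanSpace ℝ (Fin n)}
    (hx : σ⁻¹ • (-lam - x) ∈ subdiff D.primal x) (y : EuclideanSpace ℝ (Fin m))
    (z : EuclideanSpace ℝ (Fin n)) :
    1 / 2 * ‖y - D.dualY x‖ ^ 2 + 1 / (2 * σ) * ‖-(lam + σ • (D.VT y + z)) - x‖ ^ 2 ≤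
      D.gap σ y z lam := by
  have hlow : ∀ y z, -D.primal x - 1 / (2 * σ) * ‖-x - lam‖ ^ 2 + (1 / 2 * ‖y - D.dualY x‖ ^ 2 +
      1 / (2 * σ) * ‖-(lam + σ • (D.VT y + z)) - x‖ ^ 2) ≤ D.augLag σ y z lam := fun y z => by
    rw [D.augLag_eq hσ y z lam (-x), ← norm_neg (lam + σ • (D.VT y + z) - -x)]
    rw [show -(lam + σ • (D.VT y + z) - -x) = -(lam + σ • (D.VT y + z)) - x by abel]
    linarith [D.lag_ge y z x]
  have hz := D.mem_subdiff_primal_iff.1 hx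
  have hopt : D.augLag σ (D.dualY x) (σ⁻¹ • (-lam - x) - D.gradData x) lam =
      -D.primal x - 1 / (2 * σ) * ‖-x - lam‖ ^ 2 := by
    rw [D.augLag_eq hσ _ _ lam (-x), D.lag_eq hz]
    have h1 : lam + σ • (D.VT (D.dualY x) + (σ⁻¹ • (-lam - x) - D.gradData x)) - -x = 0 := by
      change lam + σ • (D.gradData x + (σ⁻¹ • (-lam - x) - D.gradData x)) - -x = 0
      rw [add_sub_cancel, smul_inv_smul₀ hσ.ne']
      abel
    rw [h1, norm_zero]
    ring
  have hinf : (⨅ w : EuclideanSpace ℝ (Fin m) × EuclideanSpace ℝ (Fin n),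
      D.augLag σ w.1 w.2 lam) ≤ -D.primal x - 1 / (2 * σ) * ‖-x - lam‖ ^ 2 := by
    rw [← hopt]
    refine ciInf_le ⟨-D.primal x - 1 / (2 * σ) * ‖-x - lam‖ ^ 2, ?_⟩
      (D.dualY x, σ⁻¹ • (-lam - x) - D.gradData x)
    rintro _ ⟨w, rfl⟩
    have := hlow w.1 w.2
    have h2 : 0 ≤ 1 / 2 * ‖w.1 - D.dualY x‖ ^ 2 +
      1 / (2 * σ) * ‖-(lam + σ • (D.VT w.1 + w.2)) - x‖ ^ 2 := by positivity
    dsimp only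
    linarith
  have := hlow y z
  simp only [gap]
  linarith

end SparseSource

/-! ### Metric subregularity -/

theorem MetricallySubregular.of_norm_sub_le {E G : Type*} [SeminormedAddCommGroup E]
    [SeminormedAddCommGroup G] {F : E → Set G} {xbar : E} {K : ℝ} (h0 : 0 ∈ F xbar) (hK : 0 ≤ K)
    (h : ∀ x v, v ∈ F x → ‖x - xbar‖ ≤ K * ‖v‖) : MetricallySubregular F xbar 0 K := by
  refine ⟨h0, hK, Set.univ, univ_mem, Set.univ, univ_mem, fun x _ hne => ?_⟩
  rw [Set.inter_univ] at hne ⊢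
  refine (Metric.infDist_le_dist_of_mem (y := xbar) h0).trans ?_
  rw [dist_eq_norm]
  rcases hK.eq_or_lt with rfl | hK
  · obtain ⟨v, hv⟩ := hne
    simpa using h x v hv
  · rw [← div_le_iff₀' hK]
    refine (Metric.le_infDist hne).2 fun v hv => ?_
    rw [dist_zero_left, div_le_iff₀' hK]
    exact h x v hv

/-- Metric subregularity along a sequence when `xbar` is the only zero. -/
theorem MetricallySubregular.eventually_norm_sub_le {E G : Type*} [SeminormedAddCommGroup E]
    [SeminormedAddCommGroup G] {F : E → Set G} {xbar : E} {κ : ℝ}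
    (h : MetricallySubregular F xbar 0 κ) (hinv : {x | 0 ∈ F x} = {xbar}) {x : ℕ → E} {v : ℕ → G}
    (hx : Tendsto x atTop (𝓝 xbar)) (hv : Tendsto v atTop (𝓝 0)) (hvx : ∀ k, v k ∈ F (x k)) :
    ∀ᶠ k in atTop, ‖x k - xbar‖ ≤ κ * ‖v k‖ := by
  obtain ⟨-, hκ, U, hU, W, hW, h⟩ := h
  filter_upwards [hx hU, hv hW] with k hkU hkW
  have h1 := h (x k) hkU ⟨v k, hvx k, hkW⟩
  rw [hinv, Metric.infDist_singleton, dist_eq_norm] at h1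
  refine h1.trans ?_
  gcongr
  refine (Metric.infDist_le_dist_of_mem (y := v k) (Set.mem_inter (hvx k) hkW)).trans ?_
  rw [dist_zero_left]

/-! ### The limits of the rates -/

theorem eq_top_or_exists_tendsto {σ : ℕ → ℝ} (hpos : ∀ k, 0 < σ k) (hmono : Monotone σ)
    {σinf : EReal} (h : Tendsto (fun k => (σ k : EReal)) atTop (𝓝 σinf)) :
    (σinf = ⊤ ∧ Tendsto σ atTop atTop) ∨ ∃ s : ℝ, 0 < s ∧ σinf = s ∧ Tendsto σ atTop (𝓝 s) := by
  have h0 : ((σ 0 : ℝ) : EReal) ≤ σinf :=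
    ge_of_tendsto' h fun k => EReal.coe_le_coe_iff.2 (hmono (Nat.zero_le k))
  induction σinf with
  | bot => exact absurd h0 (not_le.2 (EReal.bot_lt_coe _))
  | top => exact Or.inl ⟨rfl, EReal.tendsto_coe_nhds_top_iff.1 h⟩
  | coe s =>
    exact Or.inr ⟨s, (hpos 0).trans_le (EReal.coe_le_coe_iff.1 h0), rfl, EReal.tendsto_coe.1 h⟩

theorem tendsto_dualRateLimit {σ : ℕ → ℝ} (hpos : ∀ k, 0 < σ k) (hmono : Monotone σ)
    {σinf : EReal} (h : Tendsto (fun k => (σ k : EReal)) atTop (𝓝 σinf)) (κ : ℝ) :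
    Tendsto (fun k => κ * (κ ^ 2 + σ k ^ 2) ^ (-(1 / 2) : ℝ)) atTop
      (𝓝 (dualRateLimit κ σinf)) := by
  rcases eq_top_or_exists_tendsto hpos hmono h with ⟨rfl, hσ⟩ | ⟨s, hs, rfl, hσ⟩
  · have h1 : Tendsto (fun k => κ ^ 2 + σ k ^ 2) atTop atTop :=
      tendsto_atTop_add_const_left _ _ ((tendsto_pow_atTop two_ne_zero).comp hσ)
    have h2 := ((tendsto_rpow_neg_atTop (y := (1 / 2 : ℝ)) (by norm_num)).comp h1).const_mul κ
    rw [mul_zero] at h2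
    simpa [dualRateLimit] using h2
  · have h1 : Tendsto (fun k => κ ^ 2 + σ k ^ 2) atTop (𝓝 (κ ^ 2 + s ^ 2)) :=
      (hσ.pow 2).const_add _
    have h2 := (h1.rpow_const (p := (-(1 / 2) : ℝ)) (Or.inl (by positivity))).const_mul κ
    simpa [dualRateLimit] using h2

theorem dualRateLimit_lt_one {σ : ℕ → ℝ} (hpos : ∀ k, 0 < σ k) (hmono : Monotone σ)
    {σinf : EReal} (h : Tendsto (fun k => (σ k : EReal)) atTop (𝓝 σinf)) (κ : ℝ) :
    dualRateLimit κ σinf < 1 := by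
  rcases eq_top_or_exists_tendsto hpos hmono h with ⟨rfl, -⟩ | ⟨s, hs, rfl, -⟩
  · simp [dualRateLimit]
  · have h1 : 0 < κ ^ 2 + s ^ 2 := by positivity
    rw [dualRateLimit, if_neg (EReal.coe_ne_top s), EReal.toReal_coe, Real.rpow_neg h1.le,
      ← Real.sqrt_eq_rpow, ← div_eq_mul_inv, div_lt_one (Real.sqrt_pos.2 h1)]
    exact Real.lt_sqrt_of_sq_lt (by linarith [pow_pos hs 2])

theorem tendsto_primalRateLimit {σ : ℕ → ℝ} (hpos : ∀ k, 0 < σ k) (hmono : Monotone σ)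
    {σinf : EReal} (h : Tendsto (fun k => (σ k : EReal)) atTop (𝓝 σinf)) (κ : ℝ) {δ : ℕ → ℝ}
    (hδ : Tendsto δ atTop (𝓝 0)) :
    Tendsto (fun k => κ * (1 + δ k) / σ k) atTop (𝓝 (primalRateLimit κ σinf)) := by
  have h1 : Tendsto (fun k => κ * (1 + δ k)) atTop (𝓝 κ) := by
    simpa using (hδ.const_add 1).const_mul κ
  rcases eq_top_or_exists_tendsto hpos hmono h with ⟨rfl, hσ⟩ | ⟨s, hs, rfl, hσ⟩
  · simpa [primalRateLimit] using h1.div_atTop hσ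
  · have h2 := h1.div hσ hs.ne'
    simp only [primalRateLimit, EReal.coe_ne_top, if_false, EReal.toReal_coe]
    exact h2

theorem le_rate_mul {κ σ a b q : ℝ} (hκ : 0 ≤ κ) (hσ : 0 < σ) (ha : 0 ≤ a) (hb : 0 ≤ b)
    (h : b ≤ κ * (σ⁻¹ * q)) (hsq : b ^ 2 + q ^ 2 ≤ a ^ 2) :
    b ≤ κ * (κ ^ 2 + σ ^ 2) ^ (-(1 / 2) : ℝ) * a := by
  have h1 : 0 < κ ^ 2 + σ ^ 2 := by positivity
  rw [Real.rpow_neg h1.le, ← Real.sqrt_eq_rpow, mul_right_comm, ← div_eq_mul_inv,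
    le_div_iff₀ (Real.sqrt_pos.2 h1)]
  refine abs_le_of_sq_le_sq' ?_ (mul_nonneg hκ ha) |>.2
  rw [mul_pow, Real.sq_sqrt h1.le]
  have h2 : σ * b ≤ κ * q := by
    have := mul_le_mul_of_nonneg_left h hσ.le
    rwa [mul_left_comm, mul_inv_cancel_left₀ hσ.ne'] at this
  have h3 := pow_le_pow_left₀ (by positivity) h2 2
  have h4 := mul_le_mul_of_nonneg_left hsq (sq_nonneg κ)
  linarith

theorem le_of_half_inv_mul_sq_le {σ a b : ℝ} (hσ : 0 < σ) (hb : 0 ≤ b)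
    (h : 1 / (2 * σ) * a ^ 2 ≤ b ^ 2 / (2 * σ)) : a ≤ b := by
  refine abs_le_of_sq_le_sq' ?_ hb |>.2
  rwa [one_div_mul_eq_div, div_le_div_iff_of_pos_right (by positivity)] at h

/-- Sequences that decrease by a multiple of `b k`, up to a summable error. -/
theorem tendsto_zero_of_add_le {a b ε : ℕ → ℝ} {η : ℝ} (hη : 0 < η) (ha : ∀ k, 0 ≤ a k)
    (hb : ∀ k, 0 ≤ b k) (hε0 : ∀ k, 0 ≤ ε k) (hε : Summable ε)
    (h : ∀ k, a (k + 1) + η * b k ≤ a k + ε k) : Tendsto b atTop (𝓝 0) := by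
  have h1 : ∀ N, a N + η * ∑ k ∈ Finset.range N, b k ≤ a 0 + ∑ k ∈ Finset.range N, ε k := by
    intro N
    induction N with
    | zero => simp
    | succ N ih =>
      rw [Finset.sum_range_succ, Finset.sum_range_succ]
      linarith [h N]
  refine (summable_of_sum_range_le (c := (a 0 + ∑' k, ε k) / η) hb fun N => ?_).tendsto_atTop_zero
  rw [le_div_iff₀' hη]
  linarith [h1 N, ha N, hε.sum_le_tsum (Finset.range N) fun k _ => hε0 k]

namespace SparseSource

variable {m n : ℕ} (D : SparseSource m n)

/-- Convergence of the inexact proximal point iterates and of the multipliers. -/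
theorem tendsto_prox_and_multiplier {σ ε : ℕ → ℝ} (hσ_pos : ∀ k, 0 < σ k) (hσ_mono : Monotone σ)
    {lam μ : ℕ → EuclideanSpace ℝ (Fin n)} {xbar : EuclideanSpace ℝ (Fin n)}
    (hxbar : 0 ∈ subdiff D.primal xbar)
    (hμ : ∀ k, (σ k)⁻¹ • (-lam k - μ k) ∈ subdiff D.primal (μ k))
    (hε0 : ∀ k, 0 ≤ ε k) (hε : Summable ε) (herr : ∀ k, ‖-lam (k + 1) - μ k‖ ≤ ε k) :
    Tendsto μ atTop (𝓝 xbar) ∧ Tendsto lam atTop (𝓝 (-xbar)) := by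
  have hμ0 : Tendsto (fun k => ‖μ k - xbar‖) atTop (𝓝 0) := by
    refine tendsto_zero_of_add_le (a := fun k => ‖-lam k - xbar‖) (ε := ε)
      (mul_pos (hσ_pos 0) D.α₀_pos) (fun k => norm_nonneg _) (fun k => norm_nonneg _) hε0 hε
      fun k => ?_
    have h1 := D.prox_contract (hσ_pos k) (hμ k) hxbar
    have h2 : ‖-lam (k + 1) - xbar‖ ≤ ‖-lam (k + 1) - μ k‖ + ‖μ k - xbar‖ :=
      norm_sub_le_norm_sub_add_norm_sub _ _ _
    have h3 : σ 0 * D.α₀ * ‖μ k - xbar‖ ≤ σ k * D.α₀ * ‖μ k - xbar‖ := by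
      have := D.α₀_pos
      gcongr
      exact hσ_mono (Nat.zero_le k)
    linarith [herr k]
  have hμt : Tendsto μ atTop (𝓝 xbar) := tendsto_iff_norm_sub_tendsto_zero.2 hμ0
  refine ⟨hμt, ?_⟩
  have h1 : Tendsto (fun k => -lam (k + 1) - μ k) atTop (𝓝 0) :=
    squeeze_zero_norm herr hε.tendsto_atTop_zero
  have h2 : Tendsto (fun k => -lam (k + 1)) atTop (𝓝 xbar) := by
    simpa using h1.add hμt
  have h3 := h2.neg
  simp only [neg_neg] at h3
  exact (tendsto_add_atTop_iff_nat 1).1 h3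

/-- Linear convergence of the inexact proximal point iterates under metric subregularity. -/
theorem eventually_norm_sub_le_of_subregular {σ δ : ℕ → ℝ} (hσ_pos : ∀ k, 0 < σ k)
    {lam μ : ℕ → EuclideanSpace ℝ (Fin n)} {xbar : EuclideanSpace ℝ (Fin n)} {κ : ℝ}
    (hxbar : 0 ∈ subdiff D.primal xbar)
    (hμ : ∀ k, (σ k)⁻¹ • (-lam k - μ k) ∈ subdiff D.primal (μ k))
    (hμt : Tendsto μ atTop (𝓝 xbar))
    (hv : Tendsto (fun k => (σ k)⁻¹ • (-lam k - μ k)) atTop (𝓝 0))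
    (hκ : MetricallySubregular (subdiff D.primal) xbar 0 κ)
    (hδ0 : ∀ k, 0 ≤ δ k) (hδt : Tendsto δ atTop (𝓝 0))
    (herr : ∀ k, ‖-lam (k + 1) - μ k‖ ≤ δ k * ‖lam (k + 1) - lam k‖) :
    ∀ᶠ k in atTop, ‖-lam (k + 1) - xbar‖ ≤
      (κ * (κ ^ 2 + σ k ^ 2) ^ (-(1 / 2) : ℝ) + δ k) * (1 - δ k)⁻¹ * ‖-lam k - xbar‖ := by
  have hzero : {x | 0 ∈ subdiff D.primal x} = {xbar} := by
    rw [← D.solutionSet_eq_singleton hxbar]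
    ext x
    rw [Set.mem_ofPred_eq, D.mem_solutionSet_iff]
  filter_upwards [hκ.eventually_norm_sub_le hzero hμt hv hμ,
    hδt.eventually_lt_const one_pos] with k hk hδ1
  rw [norm_smul, norm_inv, Real.norm_of_nonneg (hσ_pos k).le] at hk
  have hprox := D.prox_sq_le (hσ_pos k) (hμ k) hxbar
  have hnn : 0 ≤ 2 * σ k * D.α₀ * ‖μ k - xbar‖ ^ 2 := by
    have := hσ_pos k
    have := D.α₀_pos
    positivity
  have h1 := le_rate_mul hκ.2.1 (hσ_pos k) (norm_nonneg (-lam k - xbar)) (norm_nonneg _) hk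
    (by linarith)
  have h2 := herr k
  have h3 : ‖lam (k + 1) - lam k‖ ≤ ‖-lam (k + 1) - xbar‖ + ‖-lam k - xbar‖ := by
    rw [show lam (k + 1) - lam k = (-lam k - xbar) - (-lam (k + 1) - xbar) by abel, add_comm ‖_‖]
    exact norm_sub_le (-lam k - xbar) (-lam (k + 1) - xbar)
  have h4 : ‖-lam (k + 1) - xbar‖ ≤ ‖-lam (k + 1) - μ k‖ + ‖μ k - xbar‖ :=
    norm_sub_le_norm_sub_add_norm_sub _ _ _
  have h5 := mul_le_mul_of_nonneg_left h3 (hδ0 k)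
  rw [mul_right_comm, ← div_eq_mul_inv, le_div_iff₀ (sub_pos.2 hδ1)]
  linarith

/-- The bound of the dual iterates by the step of the multiplier under metric subregularity. -/
theorem eventually_norm_mkYZ_sub_le_of_subregular {σ δ : ℕ → ℝ} (hσ_pos : ∀ k, 0 < σ k)
    (hinv : ∀ k, (σ k)⁻¹ ≤ (σ 0)⁻¹) {y : ℕ → EuclideanSpace ℝ (Fin m)}
    {z lam : ℕ → EuclideanSpace ℝ (Fin n)} {xbar : EuclideanSpace ℝ (Fin n)} {κ : ℝ}
    (hxbar : 0 ∈ subdiff D.primal xbar)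
    (hlam : ∀ k, lam (k + 1) = lam k + σ k • (D.VT (y (k + 1)) + z (k + 1)))
    (hu : ∀ k, (σ k)⁻¹ • (lam (k + 1) - lam k) = D.VT (y (k + 1)) + z (k + 1))
    (hall : Tendsto (fun k => (y (k + 1), z (k + 1), lam (k + 1))) atTop
      (𝓝 (D.dualY xbar, -D.VT (D.dualY xbar), -xbar)))
    (hdiff : Tendsto (fun k => lam (k + 1) - lam k) atTop (𝓝 0))
    (hκ : MetricallySubregular D.Tl (mkYZL (D.dualY xbar) (-D.VT (D.dualY xbar)) (-xbar)) 0 κ)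
    (hB : D.StopB2 σ δ y z lam) :
    ∀ᶠ k in atTop,
      ‖mkYZ (y (k + 1)) (z (k + 1)) - mkYZ (D.dualY xbar) (-D.VT (D.dualY xbar))‖ ≤
        κ * (1 + δ k) / σ k * ‖lam (k + 1) - lam k‖ := by
  obtain ⟨hδ0, hδt, hB⟩ := hB
  choose g hg using fun k => D.exists_mem_subdiff_p (z (k + 1))
  set q : ℕ → YZ m n := fun k =>
    mkYZ (y (k + 1) + D.ub + D.V (lam (k + 1))) (g k + lam (k + 1)) with hq
  set v : ℕ → YZL m n := fun k => WithLp.toLp 2 (q k, -(D.VT (y (k + 1)) + z (k + 1))) with hv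
  have hmem : ∀ k, v k ∈ D.Tl (mkYZL (y (k + 1)) (z (k + 1)) (lam (k + 1))) := fun k => by
    rw [D.Tl_eq _ (hg k)]
    rfl
  have hqn : ∀ k, ‖q k‖ ≤ δ k / σ k * ‖lam (k + 1) - lam k‖ := fun k => by
    have h1 := hB k
    rwa [D.subdiff_augLag (hσ_pos k) _ (hg k), ← hlam k, Metric.infDist_singleton,
      dist_zero_left] at h1
  have hvn : ∀ k, ‖v k‖ ≤ (1 + δ k) / σ k * ‖lam (k + 1) - lam k‖ := fun k => by
    have h1 : ‖v k‖ ^ 2 = ‖q k‖ ^ 2 + ‖-(D.VT (y (k + 1)) + z (k + 1))‖ ^ 2 :=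
      WithLp.prod_norm_sq_eq_of_L2 _
    rw [norm_neg, ← hu k, norm_smul, norm_inv, Real.norm_of_nonneg (hσ_pos k).le] at h1
    have h2 : 0 ≤ (σ k)⁻¹ * ‖lam (k + 1) - lam k‖ :=
      mul_nonneg (inv_nonneg.2 (hσ_pos k).le) (norm_nonneg _)
    have h3 : ‖v k‖ ≤ ‖q k‖ + (σ k)⁻¹ * ‖lam (k + 1) - lam k‖ := by
      refine abs_le_of_sq_le_sq' ?_ (by positivity) |>.2
      nlinarith [mul_nonneg (norm_nonneg (q k)) h2]
    rw [add_div, one_div, add_mul]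
    linarith [hqn k]
  have hvt : Tendsto v atTop (𝓝 0) := by
    refine squeeze_zero_norm (a := fun k => (1 + δ k) * (σ 0)⁻¹ * ‖lam (k + 1) - lam k‖)
      (fun k => (hvn k).trans ?_) ?_
    · rw [div_eq_mul_inv]
      have := hδ0 k
      exact mul_le_mul_of_nonneg_right (mul_le_mul_of_nonneg_left (hinv k) (by linarith))
        (norm_nonneg _)
    · simpa using ((hδt.const_add 1).mul_const (σ 0)⁻¹).mul hdiff.norm
  have hxt : Tendsto (fun k => mkYZL (y (k + 1)) (z (k + 1)) (lam (k + 1))) atTop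
      (𝓝 (mkYZL (D.dualY xbar) (-D.VT (D.dualY xbar)) (-xbar))) := by
    have hcont : Continuous fun w : EuclideanSpace ℝ (Fin m) × EuclideanSpace ℝ (Fin n) ×
        EuclideanSpace ℝ (Fin n) => mkYZL w.1 w.2.1 w.2.2 := by
      unfold mkYZL mkYZ
      fun_prop
    exact (hcont.tendsto _).comp hall
  filter_upwards [hκ.eventually_norm_sub_le (D.Tl_inv_zero hxbar) hxt hvt hmem] with k hk
  have h1 := norm_mkYZL_sq (y (k + 1) - D.dualY xbar) (z (k + 1) - -D.VT (D.dualY xbar))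
    (lam (k + 1) - -xbar)
  have h2 : ‖mkYZ (y (k + 1)) (z (k + 1)) - mkYZ (D.dualY xbar) (-D.VT (D.dualY xbar))‖ ≤
      ‖mkYZL (y (k + 1)) (z (k + 1)) (lam (k + 1)) -
        mkYZL (D.dualY xbar) (-D.VT (D.dualY xbar)) (-xbar)‖ := by
    refine abs_le_of_sq_le_sq' ?_ (norm_nonneg _) |>.2
    exact (le_add_of_nonneg_right (sq_nonneg _)).trans h1.ge
  refine h2.trans (hk.trans ?_)
  rw [mul_div_assoc, mul_assoc]
  exact mul_le_mul_of_nonneg_left (hvn k) hκ.2.1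

end SparseSource

theorem mainTheorem4 {m n : ℕ} (D : SparseSource m n)
    (σ : ℕ → ℝ) (hσ_pos : ∀ k, 0 < σ k) (hσ_mono : Monotone σ)
    (σinf : EReal) (hσinf : Tendsto (fun k => (σ k : EReal)) atTop (𝓝 σinf))
    (β c : ℝ) (hβ₀ : 0 < β) (hβ₁ : β < 1) (hc : 0 < c)
    (y : ℕ → EuclideanSpace ℝ (Fin m)) (z lam : ℕ → EuclideanSpace ℝ (Fin n))
    (halg : D.IsALMbdSSN σ β c y z lam)
    (ε : ℕ → ℝ) (hA : D.StopA σ ε y z lam) :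
    Bornology.IsBounded (Set.range fun k => (y k, z k, lam k)) ∧
    ∃ (ystar : EuclideanSpace ℝ (Fin m)) (zstar lamstar : EuclideanSpace ℝ (Fin n)),
      D.IsKKT ystar zstar lamstar ∧
      Tendsto (fun k => (y k, z k, lam k)) atTop (𝓝 (ystar, zstar, lamstar)) ∧
      -lamstar ∈ D.solutionSet ∧
      (∃ κd : ℝ, MetricallySubregular (subdiff D.primal) (-lamstar) 0 κd) ∧
      (∀ κd : ℝ, MetricallySubregular (subdiff D.primal) (-lamstar) 0 κd →
        ∀ δ : ℕ → ℝ, D.StopB1 σ δ y z lam →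
        ∀ θ : ℕ → ℝ,
          (∀ k, θ k = (κd * (κd ^ 2 + σ k ^ 2) ^ (-(1 / 2) : ℝ) + δ k) * (1 - δ k)⁻¹) →
          (∀ᶠ k in atTop, Metric.infDist (-lam (k + 1)) D.solutionSet ≤
            θ k * Metric.infDist (-lam k) D.solutionSet) ∧
          Tendsto θ atTop (𝓝 (dualRateLimit κd σinf)) ∧ dualRateLimit κd σinf < 1) ∧
      (∃ κl : ℝ, MetricallySubregular D.Tl (SparseSource.mkYZL ystar zstar lamstar) 0 κl) ∧
      (∀ κl : ℝ, MetricallySubregular D.Tl (SparseSource.mkYZL ystar zstar lamstar) 0 κl →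
        ∀ δ' : ℕ → ℝ, D.StopB2 σ δ' y z lam →
        ∀ θ' : ℕ → ℝ, (∀ k, θ' k = κl * (1 + δ' k) / σ k) →
          (∀ᶠ k in atTop,
            ‖SparseSource.mkYZ (y (k + 1)) (z (k + 1)) - SparseSource.mkYZ ystar zstar‖ ≤
              θ' k * ‖lam (k + 1) - lam k‖) ∧
          Tendsto θ' atTop (𝓝 (primalRateLimit κl σinf))) := by
  obtain ⟨xbar, hxbar⟩ := D.exists_zero_mem_subdiff_primal
  choose μ hμ using fun k => D.exists_prox (hσ_pos k) (-lam k)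
  have hlam : ∀ k, lam (k + 1) = lam k + σ k • (D.VT (y (k + 1)) + z (k + 1)) :=
    fun k => (halg k).2.2
  have hgap : ∀ k, 1 / 2 * ‖y (k + 1) - D.dualY (μ k)‖ ^ 2 +
      1 / (2 * σ k) * ‖-lam (k + 1) - μ k‖ ^ 2 ≤
        D.gap (σ k) (y (k + 1)) (z (k + 1)) (lam k) := fun k => by
    rw [hlam k]
    exact D.le_gap (hσ_pos k) (hμ k) _ _
  obtain ⟨hε0, hε, hgapA⟩ := hA
  have herr : ∀ k, ‖-lam (k + 1) - μ k‖ ≤ ε k := fun k =>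
    le_of_half_inv_mul_sq_le (hσ_pos k) (hε0 k)
      (by linarith [hgap k, hgapA k, sq_nonneg ‖y (k + 1) - D.dualY (μ k)‖])
  obtain ⟨hμt, hlamt⟩ := D.tendsto_prox_and_multiplier hσ_pos hσ_mono hxbar hμ hε0 hε herr
  have hlamt1 := hlamt.comp (tendsto_add_atTop_nat 1)
  have hdiff : Tendsto (fun k => lam (k + 1) - lam k) atTop (𝓝 0) := by
    simpa using hlamt1.sub hlamt
  have hinv : ∀ k, (σ k)⁻¹ ≤ (σ 0)⁻¹ := fun k =>
    inv_anti₀ (hσ_pos 0) (hσ_mono (Nat.zero_le k))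
  have hscale : ∀ u : ℕ → EuclideanSpace ℝ (Fin n), Tendsto u atTop (𝓝 0) →
      Tendsto (fun k => (σ k)⁻¹ • u k) atTop (𝓝 0) := fun u hu => by
    refine squeeze_zero_norm (a := fun k => (σ 0)⁻¹ * ‖u k‖) (fun k => ?_) ?_
    · rw [norm_smul, norm_inv, Real.norm_of_nonneg (hσ_pos k).le]
      exact mul_le_mul_of_nonneg_right (hinv k) (norm_nonneg _)
    · simpa using hu.norm.const_mul (σ 0)⁻¹
  have hyt : Tendsto y atTop (𝓝 (D.dualY xbar)) := by
    have h1 : Tendsto (fun k => y (k + 1) - D.dualY (μ k)) atTop (𝓝 0) := by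
      refine squeeze_zero_norm (a := fun k => ε k / √(σ 0)) (fun k => ?_) ?_
      · have h0 := Real.sqrt_pos.2 (hσ_pos 0)
        refine abs_le_of_sq_le_sq' ?_ (div_nonneg (hε0 k) h0.le) |>.2
        have h2 : 0 ≤ 1 / (2 * σ k) * ‖-lam (k + 1) - μ k‖ ^ 2 := by
          have := hσ_pos k
          positivity
        have h3 := mul_le_mul_of_nonneg_left (hinv k) (sq_nonneg (ε k))
        have h4 : ε k ^ 2 / (2 * σ k) = 1 / 2 * (ε k ^ 2 * (σ k)⁻¹) := by
          have := (hσ_pos k).ne'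
          field_simp
        rw [div_pow, Real.sq_sqrt (hσ_pos 0).le, div_eq_mul_inv]
        linarith [hgap k, hgapA k]
      · simpa using hε.tendsto_atTop_zero.div_const (√(σ 0))
    have h2 : Tendsto (fun k => D.dualY (μ k)) atTop (𝓝 (D.dualY xbar)) :=
      ((D.V.continuous.tendsto xbar).comp hμt).sub_const _
    refine (tendsto_add_atTop_iff_nat 1).1 ?_
    simpa using h1.add h2
  have hyt1 := hyt.comp (tendsto_add_atTop_nat 1)
  have hu : ∀ k, (σ k)⁻¹ • (lam (k + 1) - lam k) = D.VT (y (k + 1)) + z (k + 1) := fun k => by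
    rw [hlam k, add_sub_cancel_left, inv_smul_smul₀ (hσ_pos k).ne']
  have hzt : Tendsto z atTop (𝓝 (-D.VT (D.dualY xbar))) := by
    refine (tendsto_add_atTop_iff_nat 1).1 ?_
    have h1 := (hscale _ hdiff).sub ((D.VT.continuous.tendsto _).comp hyt1)
    rw [zero_sub] at h1
    refine h1.congr fun k => ?_
    rw [hu]
    exact add_sub_cancel_left _ _
  have hall : Tendsto (fun k => (y k, z k, lam k)) atTop
      (𝓝 (D.dualY xbar, -D.VT (D.dualY xbar), -xbar)) :=
    hyt.prodMk_nhds (hzt.prodMk_nhds hlamt)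
  have hsol := D.solutionSet_eq_singleton hxbar
  refine ⟨Metric.isBounded_range_of_tendsto _ hall, D.dualY xbar, -D.VT (D.dualY xbar), -xbar,
    D.isKKT_of_mem hxbar, hall, ?_, ?_, ?_, ?_, ?_⟩
  · rw [neg_neg, hsol]; rfl
  · rw [neg_neg]
    refine ⟨D.α₀⁻¹, .of_norm_sub_le hxbar (inv_nonneg.2 D.α₀_pos.le) fun x v hv => ?_⟩
    rw [← div_eq_inv_mul, le_div_iff₀' D.α₀_pos]
    exact D.mul_norm_le_of_mem_subdiff_primal hv hxbar
  · intro κ hκ δ hδ θ hθ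
    rw [neg_neg] at hκ
    obtain ⟨hδ0, hδs, hgapB⟩ := hδ
    have hδt := hδs.tendsto_atTop_zero
    refine ⟨?_, ?_, dualRateLimit_lt_one hσ_pos hσ_mono hσinf κ⟩
    · rw [hsol]
      simp only [Metric.infDist_singleton, dist_eq_norm, hθ]
      refine D.eventually_norm_sub_le_of_subregular hσ_pos hxbar hμ hμt
        (hscale _ (by simpa using hlamt.neg.sub hμt)) hκ hδ0 hδt fun k =>
        le_of_half_inv_mul_sq_le (hσ_pos k) (mul_nonneg (hδ0 k) (norm_nonneg _)) ?_
      rw [mul_pow, mul_div_right_comm]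
      linarith [hgap k, hgapB k, sq_nonneg ‖y (k + 1) - D.dualY (μ k)‖]
    · have h1 := ((tendsto_dualRateLimit hσ_pos hσ_mono hσinf κ).add hδt).mul
        ((hδt.const_sub 1).inv₀ (by norm_num))
      rw [sub_zero, inv_one, mul_one, add_zero] at h1
      exact h1.congr fun k => (hθ k).symm
  · obtain ⟨K, hK0, hK⟩ := D.exists_norm_le_Tl hxbar
    refine ⟨K, .of_norm_sub_le ?_ hK0 hK⟩
    rw [D.Tl_kkt hxbar]
    rfl
  · intro κ hκ δ hδ θ hθ
    refine ⟨?_, (tendsto_primalRateLimit hσ_pos hσ_mono hσinf κ hδ.2.1).congr fun k => (hθ k).symm⟩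
    simp only [hθ]
    exact D.eventually_norm_mkYZ_sub_le_of_subregular hσ_pos hinv hxbar hlam hu
      (hall.comp (tendsto_add_atTop_nat 1)) hdiff hκ hδ
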